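/- Let $d\ge 1$, and for $\theta=[\mu;\sigma]\in\mathbb R^{2d}$ with $\mu\in\mathbb R^d$ and $\sigma=(\sigma_1^2,\dots,\sigma_d^2)\in(0,\infty)^d$ let $P_\theta=\mathcal N(\mu,\mathrm{diag}(\sigma_1^2,\dots,\sigma_d^2))$. Let $\mathcal T\subset\mathbb R^{d}\times(0,\infty)^d$ be a nonempty compact set and $\mathcal G=\{P_\theta:\theta\in\mathcal T\}$. Let $\sigma_{\min}^2$ and $\sigma_{\max}^2$ be the smallest and the largest value of $\sigma_\ell^2$ over $[\mu;\sigma]\in\mathcal T$ and $1\le\ell\le d$, let $M=\max_{[\mu;\sigma]\in\mathcal T}\|\mu\|_2$, and let $\mathrm{rad}(\mathcal T)$ be the infimum of the $r>0$ such that $\mathcal T$ is contained in a closed Euclidean ball of radius $r$ in $\mathbb R^{2d}$. For a probability distribution $P$ on $\mathbb R^d$ let $\chi_P(\omega)=\int e^{-\mathsf i\omega^Tx}\,dP(x)$. For frequencies $\omega_1,\dots,\omega_m\in\mathbb R^d$ let $\mathcal A P=\frac1{\sqrt m}(\chi_P(\omega_1),\dots,\chi_P(\omega_m))\in\mathbb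 C^m$. Let $a>0$ and $\Lambda=\mathcal N(0,\frac adI)$, and let $$\gamma_\Lambda(P,Q)=\Big(\int_{\mathbb R^d}|\chi_P(\omega)-\chi_Q(\omega)|^2\,d\Lambda(\omega)\Big)^{1/2}.$$ Let $\|\cdot\|_{TV}$ be the total variation norm ($\|\nu\|_{TV}=|\nu|(\mathbb R^d)$) and $d_{TV}(P,\mathcal G)=\inf_{Q\in\mathcal G}\|P-Q\|_{TV}$. Put $$B=8\max\big(\sigma_{\min}^{-1},\sigma_{\min}^{-2}/\sqrt2\big)\,\mathrm{rad}(\mathcal T),\qquad C=\sqrt{24B},\qquad D_1=\sigma_{\max}^2a\Big(1+\frac{2M^2}d\Big),$$ $$D=\max\big(\sigma_{\min}^{-1},\sigma_{\min}^{-2}/\sqrt2\big)\sqrt{\frac{2dD_1e^{3a\sigma_{\max}^2}}{a(1-e^{-D_1})}}.$$ Let $0<\eta\le1$, $A=\min(D,2/\eta)$ and $\rho>0$. Let $P^*$ be any probability distribution on $\mathbb R^d$, let $x_1,\dots,x_n$ ($n\ge1$) be drawn i.i.d. from $P^*$ and, independently, let $\omega_1,\dots,\omega_m$ be drawn i.i.d.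 from $\Lambda$. Let $\hat z=\mathcal A\hat P$ with $\hat P=\frac1n\sum_{i=1}^n\delta_{x_i}$ be the empirical sketch. Then, for all $z\in\mathbb C^m$ and all frequencies, the function $P\mapsto\|z-\mathcal AP\|_2$ attains its minimum on $\mathcal G$. Moreover, let $\Delta$ be any decoder that returns such a minimizer, $\Delta(z,\mathcal A)\in\arg\min_{P\in\mathcal G}\|z-\mathcal AP\|_2$, and let $\bar P=\Delta(\hat z,\mathcal A)$. If $$m\ge12A^2\Big(4d\log\frac C\eta+\log\frac2\rho\Big),$$ then, with probability at least $1-\rho$ on the joint draw of the $x_i$ and the $\omega_j$, $$\gamma_\Lambda(P^*,\bar P)\le5\,d_{TV}(P^*,\mathcal G)+\frac{4\big(1+\sqrt{2\log(2/\rho)}\big)}{\sqrt n}+\eta.$$ -/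

import Mathlib

open MeasureTheory ProbabilityTheory

noncomputable section

namespace SketchedGaussian

/-- The data space `ℝ^d`, with the Euclidean norm. -/
abbrev Vec (d : ℕ) : Type := EuclideanSpace ℝ (Fin d)

/-- The parameter space `ℝ^{2d}`, with the Euclidean norm. A parameter `θ` consists of the mean
`θ.fst` and of the vector `θ.snd` of the variances, i.e. the diagonal of the covariance matrix. -/
abbrev Param (d : ℕ) : Type := WithLp 2 (Vec d × Vec d)

/-- The Gaussian distribution `P_θ` with mean `θ.fst` and covariance matrix `diag (θ.snd)`. -/
def gaussianDist {d : ℕ} (θ : Param d) : ProbabilityMeasure (Vec d) :=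
  ⟨multivariateGaussian θ.fst (Matrix.diagonal fun l => θ.snd l), inferInstance⟩

/-- The model `𝒢 = {P_θ : θ ∈ T}` of single Gaussians. -/
def gaussianModel {d : ℕ} (T : Set (Param d)) : Set (ProbabilityMeasure (Vec d)) :=
  gaussianDist '' T

/-- The frequency distribution `N(0, (a/d) I)`. -/
def freqDist (d : ℕ) (a : ℝ) : Measure (Vec d) :=
  multivariateGaussian 0 ((a / d) • (1 : Matrix (Fin d) (Fin d) ℝ))

/-- The characteristic function `ω ↦ ∫ e^{-i ωᵀx} dP(x)`. -/
def chrc {d : ℕ} (P : ProbabilityMeasure (Vec d)) (ω : Vec d) : ℂ :=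
  ∫ x, Complex.exp (-(Complex.I * ((inner ℝ ω x : ℝ) : ℂ))) ∂(P : Measure (Vec d))

/-- The sketch `m^{-1/2} (χ_P(ω_1), …, χ_P(ω_m))`. -/
def sketch {d m : ℕ} (ω : Fin m → Vec d) (P : ProbabilityMeasure (Vec d)) :
    EuclideanSpace ℂ (Fin m) :=
  WithLp.toLp 2 fun j => ((1 / √(m : ℝ) : ℝ) : ℂ) * chrc P (ω j)

/-- The empirical sketch of the points `x_1, …, x_n`: the sketch with the characteristic function
replaced by the empirical one, `ω ↦ n⁻¹ ∑ i, e^{-i ωᵀx_i}`. -/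
def empiricalSketch {d m n : ℕ} (ω : Fin m → Vec d) (x : Fin n → Vec d) :
    EuclideanSpace ℂ (Fin m) :=
  WithLp.toLp 2 fun j => ((1 / √(m : ℝ) : ℝ) : ℂ) *
    ((1 / (n : ℂ)) * ∑ i, Complex.exp (-(Complex.I * ((inner ℝ (ω j) (x i) : ℝ) : ℂ))))

/-- The maximum mean discrepancy `(∫ |χ_P - χ_Q|² dΛ)^{1/2}`. -/
def mmd {d : ℕ} (Λ : Measure (Vec d)) (P Q : ProbabilityMeasure (Vec d)) : ℝ :=
  √(∫ ω, ‖chrc P ω - chrc Q ω‖ ^ 2 ∂Λ)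

/-- The total variation norm `‖P - Q‖_TV = |P - Q|(ℝ^d)`. -/
def tvDist {d : ℕ} (P Q : ProbabilityMeasure (Vec d)) : ℝ :=
  (((P : Measure (Vec d)).toSignedMeasure
    - (Q : Measure (Vec d)).toSignedMeasure).totalVariation Set.univ).toReal

/-- The distance `inf_{Q ∈ S} ‖P - Q‖_TV` from `P` to a model `S`. -/
def tvInfDist {d : ℕ} (P : ProbabilityMeasure (Vec d)) (S : Set (ProbabilityMeasure (Vec d))) : ℝ :=
  sInf (tvDist P '' S)

/-- `Δ` is an ideal decoder for the model `S`: from a vector `z ∈ ℂ^m` and the frequencies `ω` that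
define the sketching operator, it returns a minimizer over `S` of the distance from `z` to the
sketch. -/
def IsIdealDecoder {d m : ℕ} (S : Set (ProbabilityMeasure (Vec d)))
    (Δ : EuclideanSpace ℂ (Fin m) → (Fin m → Vec d) → ProbabilityMeasure (Vec d)) : Prop :=
  ∀ z ω, Δ z ω ∈ S ∧ IsMinOn (fun P => ‖z - sketch ω P‖) S (Δ z ω)

/-- The law of `n` points drawn i.i.d. from `P` and, independently, `m` frequencies drawn i.i.d.
from `Λ`. -/
def drawLaw {d : ℕ} (n m : ℕ) (P : ProbabilityMeasure (Vec d)) (Λ : Measure (Vec d)) :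
    Measure ((Fin n → Vec d) × (Fin m → Vec d)) :=
  (Measure.pi fun _ : Fin n => (P : Measure (Vec d))).prod (Measure.pi fun _ : Fin m => Λ)

/-- `σ²_min`, the smallest variance. -/
def varMin {d : ℕ} (T : Set (Param d)) : ℝ := sInf {v | ∃ θ ∈ T, ∃ l, v = θ.snd l}

/-- `σ²_max`, the largest variance. -/
def varMax {d : ℕ} (T : Set (Param d)) : ℝ := sSup {v | ∃ θ ∈ T, ∃ l, v = θ.snd l}

/-- `M`, the largest Euclidean norm of a mean. -/
def meanMax {d : ℕ} (T : Set (Param d)) : ℝ := sSup {r | ∃ θ ∈ T, r = ‖θ.fst‖}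

/-- The Chebyshev radius of `T`. -/
def chebyshevRadius {d : ℕ} (T : Set (Param d)) : ℝ :=
  sInf {r | 0 < r ∧ ∃ c : Param d, T ⊆ Metric.closedBall c r}

/-- `max (σ_min⁻¹, σ_min⁻² / √2)`. -/
def constL {d : ℕ} (T : Set (Param d)) : ℝ := max (√(varMin T))⁻¹ ((varMin T)⁻¹ / √2)

/-- `B = 8 max (σ_min⁻¹, σ_min⁻² / √2) rad(T)`. -/
def constB {d : ℕ} (T : Set (Param d)) : ℝ := 8 * constL T * chebyshevRadius T

/-- `C = √(24 B)`. -/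
def constC {d : ℕ} (T : Set (Param d)) : ℝ := √(24 * constB T)

/-- `D₁ = σ²_max a (1 + 2 M² / d)`. -/
def constD₁ {d : ℕ} (T : Set (Param d)) (a : ℝ) : ℝ :=
  varMax T * a * (1 + 2 * meanMax T ^ 2 / d)

/-- `D = max (σ_min⁻¹, σ_min⁻² / √2) √(2 d D₁ e^{3 a σ²_max} / (a (1 - e^{-D₁})))`. -/
def constD {d : ℕ} (T : Set (Param d)) (a : ℝ) : ℝ :=
  constL T * √(2 * d * constD₁ T a * Real.exp (3 * a * varMax T)
    / (a * (1 - Real.exp (-constD₁ T a))))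

/-- `A = min (D, 2 / η)`. -/
def constA {d : ℕ} (T : Set (Param d)) (a η : ℝ) : ℝ := min (constD T a) (2 / η)

end SketchedGaussian

end

noncomputable section

namespace SketchedGaussian

/-! ### Concentration: lower tails from second moments, and bounded differences -/

section Concentration

variable {E : Type*} [MeasurableSpace E] {μ : Measure E} [IsProbabilityMeasure μ]

/-! Write `γ` for the MMD and `𝒜` for the sketch. Fix `Q` in the model before anything is drawn. Two
facts suffice. The empirical sketch is within `t = (1 + √(2 log (2/ρ)))/√n` of `𝒜 P*`, by McDiarmid
(`measure_norm_empiricalSketch_sub_ge_le`). The frequencies satisfy a lower isometry at `Q`, namely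
`γ(Q, P) ≤ 2 ‖𝒜 Q - 𝒜 P‖ + η` for all `P` in the model (`exists_bad_frequencies`). Characters have
modulus one, so `‖P* - Q‖_TV` bounds both `γ(P*, Q)` and `‖𝒜 P* - 𝒜 Q‖`. Minimality of the decoded
`P̄` gives `‖𝒜 Q - 𝒜 P̄‖ ≤ 2 ‖ẑ - 𝒜 Q‖`, hence `γ(P*, P̄) ≤ TV + 4 (TV + t) + η`. The infimum over
`Q` is then taken through an increasing union of failure events.

For one pair, `‖𝒜 P - 𝒜 Q‖²` is an average of `m` independent copies of `X = |χ_P - χ_Q|²`, whose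
mean is `γ²`. As `X ≥ 0`, a bound `E X² ≤ K (E X)²` alone forces the average above `γ²/4`, up to
probability `exp (-9m/(32K))` (`measure_pi_sum_le_quarter`). The value `K = (27/8) A²` turns this
into `exp (-m/(12 A²))`.

The bound with `2/η` in place of `A` follows from `X ≤ 4` when `γ > 9η/10`. The bound with `D` is
the analytic core (`integral_norm_chrc_sub_pow_four_le`). There `X` splits into a squared difference
of Gaussian weights, due to the variances, and a term with `1 - cos`, due to the means. A Gaussian
weight only changes the variance of a Gaussian frequency law, so both parts reduce to explicit
moments: those of a quadratic form for the first, those of a cosine for the second.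

Uniformity over the model comes from a net of `T` and the Lipschitz bound
`norm_chrc_gaussianDist_sub_le`. As `Q` is fixed, the net is used for one argument only, and its
cardinality enters the union bound once. -/

lemma exp_neg_le_quadratic {x : ℝ} (hx : 0 ≤ x) : Real.exp (-x) ≤ 1 - x + x ^ 2 / 2 := by
  have h := Real.quadratic_le_exp_of_nonneg hx
  have h2 : 0 < 1 + x + x ^ 2 / 2 := by positivity
  rw [Real.exp_neg]
  refine (inv_anti₀ h2 h).trans ?_
  rw [inv_le_iff_one_le_mul₀ h2]
  -- The product `(1 - x + x²/2)(1 + x + x²/2)` equals `1 + x⁴/4`.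
  nlinarith [sq_nonneg (x ^ 2)]

/-- Lower tail of a sum of independent nonnegative random variables, in terms of the second
moment. -/
lemma measure_pi_sum_le_quarter {X : E → ℝ} (hX : Measurable X) (h0 : ∀ x, 0 ≤ X x) {c : ℝ}
    (hc : ∀ x, X x ≤ c) (hpos : 0 < ∫ x, X x ∂μ) {K : ℝ} (hK0 : 0 < K)
    (hK : ∫ x, X x ^ 2 ∂μ ≤ K * (∫ x, X x ∂μ) ^ 2) (m : ℕ) :
    (Measure.pi fun _ : Fin m => μ) {ω | ∑ j, X (ω j) ≤ m * ((∫ x, X x ∂μ) / 4)}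
      ≤ ENNReal.ofReal (Real.exp (-(9 / 32 * m / K))) := by
  set e := ∫ x, X x ∂μ with he
  -- Minimizer of the Chernoff exponent `-(3/4) l e + l² K e² / 2`, whose minimum is `-9/(32K)`.
  set l : ℝ := 3 / (4 * K * e) with hl
  have hl0 : 0 < l := by positivity
  have hXi : Integrable X μ := Integrable.of_bound hX.aestronglyMeasurable c
    (Filter.Eventually.of_forall fun x => by rw [Real.norm_of_nonneg (h0 x)]; exact hc x)
  have hX2i : Integrable (fun x => X x ^ 2) μ :=
    Integrable.of_bound (hX.pow_const 2).aestronglyMeasurable (c ^ 2)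
    (Filter.Eventually.of_forall fun x => by
      rw [Real.norm_of_nonneg (sq_nonneg _)]; exact pow_le_pow_left₀ (h0 x) (hc x) 2)
  have hei : Integrable (fun x => Real.exp (-l * X x)) μ :=
    Integrable.of_bound (by fun_prop) 1
    (Filter.Eventually.of_forall fun x => by
      rw [Real.norm_of_nonneg (Real.exp_pos _).le, Real.exp_le_one_iff]
      nlinarith [h0 x])
  have h1 : ∫ x, Real.exp (-l * X x) ∂μ ≤ Real.exp (-l * e + l ^ 2 * (K * e ^ 2) / 2) := by
    calc ∫ x, Real.exp (-l * X x) ∂μ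
        ≤ ∫ x, (1 - l * X x + l ^ 2 / 2 * X x ^ 2) ∂μ := by
          refine integral_mono hei ?_ fun x => ?_
          · exact ((integrable_const _).sub (hXi.const_mul l)).add (hX2i.const_mul _)
          · have := exp_neg_le_quadratic (mul_nonneg hl0.le (h0 x))
            simp only [neg_mul]
            linarith
      _ = 1 - l * e + l ^ 2 / 2 * ∫ x, X x ^ 2 ∂μ := by
          have hi : Integrable (fun x => 1 - l * X x) μ := (integrable_const _).sub (hXi.const_mul l)
          rw [integral_add hi (hX2i.const_mul _),
            integral_sub (integrable_const _) (hXi.const_mul l), integral_const_mul,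
            integral_const_mul]
          simp [he]
      _ ≤ (-l * e + l ^ 2 * (K * e ^ 2) / 2) + 1 := by
          nlinarith [mul_le_mul_of_nonneg_left hK (by positivity : 0 ≤ l ^ 2 / 2)]
      _ ≤ _ := Real.add_one_le_exp _
  set S : (Fin m → E) → ℝ := fun ω => ∑ j, X (ω j) with hS
  have hSm : Measurable S := by fun_prop
  have hSi : Integrable (fun ω => Real.exp (-l * S ω)) (Measure.pi fun _ : Fin m => μ) :=
    Integrable.of_bound (by fun_prop) 1
    (Filter.Eventually.of_forall fun x => by
      rw [Real.norm_of_nonneg (Real.exp_pos _).le, Real.exp_le_one_iff]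
      have : 0 ≤ S x := Finset.sum_nonneg fun i _ => h0 _
      nlinarith)
  have h2 := measure_le_le_exp_mul_mgf (μ := Measure.pi fun _ : Fin m => μ) (X := S)
    (m * (e / 4)) (by linarith : -l ≤ 0) hSi
  have h3 : mgf S (Measure.pi fun _ : Fin m => μ) (-l) = (∫ x, Real.exp (-l * X x) ∂μ) ^ m := by
    rw [mgf]
    simp only [hS, Finset.mul_sum, Real.exp_sum]
    rw [integral_fintype_prod_eq_pow (fun x => Real.exp (-l * X x)), Fintype.card_fin]
  have h4 : (Measure.pi fun _ : Fin m => μ).real {ω | S ω ≤ m * (e / 4)}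
      ≤ Real.exp (-(9 / 32 * m / K)) := by
    refine h2.trans ?_
    rw [h3]
    calc _ ≤ Real.exp (-(-l) * (m * (e / 4)))
            * Real.exp (-l * e + l ^ 2 * (K * e ^ 2) / 2) ^ m := by gcongr
      _ = Real.exp (-(9 / 32 * m / K)) := by
          rw [← Real.exp_nat_mul, ← Real.exp_add]
          congr 1
          rw [hl]
          field_simp
          ring
  rw [Measure.real] at h4
  exact (ENNReal.le_ofReal_iff_toReal_le (measure_ne_top _ _) (Real.exp_pos _).le).2 h4

/-- Hoeffding's lemma: the values of `F` lie in an interval of length `c` starting at the infimum of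
`F`. Stating it through the oscillation fits the induction below. -/
lemma integral_exp_le_of_oscillation {F : E → ℝ} (hF : Measurable F) {C : ℝ} (hC : ∀ x, |F x| ≤ C)
    {c : ℝ} (hosc : ∀ x y, |F x - F y| ≤ c) (t : ℝ) :
    ∫ x, Real.exp (t * F x) ∂μ ≤ Real.exp (t * ∫ x, F x ∂μ + t ^ 2 * c ^ 2 / 8) := by
  have hne : Nonempty E := nonempty_of_isProbabilityMeasure μ
  have hbdd : BddBelow (Set.range F) := ⟨-C, by rintro _ ⟨x, rfl⟩; exact (abs_le.1 (hC x)).1⟩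
  have hmem : ∀ x, F x ∈ Set.Icc (⨅ y, F y) ((⨅ y, F y) + c) := fun x => by
    refine ⟨ciInf_le hbdd x, ?_⟩
    have : F x - c ≤ ⨅ y, F y := le_ciInf fun y => by linarith [(abs_le.1 (hosc x y)).2]
    linarith
  have h := (hasSubgaussianMGF_of_mem_Icc (μ := μ) hF.aemeasurable
    (Filter.Eventually.of_forall hmem)).mgf_le t
  have h2 : ∫ x, Real.exp (t * F x) ∂μ
      = Real.exp (t * ∫ x, F x ∂μ) * mgf (fun ω => F ω - ∫ x, F x ∂μ) μ t := by
    rw [mgf, ← integral_const_mul]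
    refine integral_congr_ae (Filter.Eventually.of_forall fun x => ?_)
    simp only
    rw [← Real.exp_add]
    ring_nf
  rw [h2, Real.exp_add]
  gcongr
  refine h.trans (Real.exp_le_exp.2 (le_of_eq ?_))
  simp only [add_sub_cancel_left, NNReal.coe_pow, NNReal.coe_div, coe_nnnorm, NNReal.coe_ofNat,
    div_pow, Real.norm_eq_abs, sq_abs]
  ring

/-- The moment generating function of a function with bounded differences of independent
variables. -/
lemma integral_pi_exp_le_of_bounded_differences {c : ℝ} (n : ℕ) :
    ∀ (f : (Fin n → E) → ℝ), Measurable f → (∃ C, ∀ x, |f x| ≤ C) →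
    (∀ x i y, |f x - f (Function.update x i y)| ≤ c) → ∀ t : ℝ,
    ∫ x, Real.exp (t * f x) ∂(Measure.pi fun _ : Fin n => μ)
      ≤ Real.exp (t * ∫ x, f x ∂(Measure.pi fun _ : Fin n => μ) + n * (t ^ 2 * c ^ 2 / 8)) := by
  induction n with
  | zero =>
    intro f _ _ _ t
    have hf : f = fun _ => f default := funext fun x => congrArg f (Subsingleton.elim _ _)
    rw [hf]
    simp
  | succ n ih =>
    rintro f hf ⟨C, hC⟩ hd t
    have hmp := (measurePreserving_piFinSuccAbove (fun _ : Fin (n + 1) => μ) 0).symm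
    set e := (MeasurableEquiv.piFinSuccAbove (fun _ : Fin (n + 1) => E) 0).symm with he
    set ν := Measure.pi fun _ : Fin n => μ with hν
    have hem : Measurable e := e.measurable
    have hcons : ∀ p : E × (Fin n → E), e p = Fin.cons p.1 p.2 := fun p => by
      rw [he, MeasurableEquiv.piFinSuccAbove_symm_apply]
      exact Fin.insertNth_zero' p.1 p.2
    have key : ∀ g : (Fin (n + 1) → E) → ℝ, Measurable g → (∃ D, ∀ x, |g x| ≤ D) →
        ∫ x, g x ∂(Measure.pi fun _ : Fin (n + 1) => μ) = ∫ x, ∫ y, g (e (x, y)) ∂ν ∂μ := by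
      rintro g hg ⟨D, hD⟩
      rw [← hmp.integral_comp' g]
      exact integral_prod (fun p => g (e p)) (Integrable.of_bound
        (hg.comp hem).aestronglyMeasurable D (Filter.Eventually.of_forall fun p => hD _))
    have hexpb : ∃ D, ∀ x, |Real.exp (t * f x)| ≤ D := ⟨Real.exp (|t| * C), fun x => by
      rw [abs_of_pos (Real.exp_pos _)]
      refine Real.exp_le_exp.2 ((le_abs_self _).trans ?_)
      rw [abs_mul]
      exact mul_le_mul_of_nonneg_left (hC x) (abs_nonneg _)⟩
    rw [key _ (by fun_prop) hexpb, key f hf ⟨C, hC⟩]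
    -- `F` is the conditional mean given the first coordinate. It inherits oscillation `c`, so
    -- Hoeffding's lemma applies to it, while the induction hypothesis controls the fluctuation
    -- around `F x` for fixed `x`.
    set F : E → ℝ := fun x => ∫ y, f (e (x, y)) ∂ν with hFdef
    have hfe : Measurable fun p : E × (Fin n → E) => f (e p) := hf.comp hem
    have hFm : Measurable F := hfe.stronglyMeasurable.integral_prod_right.measurable
    have hint : ∀ x, Integrable (fun y => f (e (x, y))) ν := fun x =>
      Integrable.of_bound (hfe.comp measurable_prodMk_left).aestronglyMeasurable C
        (Filter.Eventually.of_forall fun p => hC _)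
    have hFC : ∀ x, |F x| ≤ C := fun x => by
      have := norm_integral_le_of_norm_le_const (μ := ν) (f := fun y => f (e (x, y))) (C := C)
        (Filter.Eventually.of_forall fun p => hC _)
      simpa using this
    have hosc : ∀ x y, |F x - F y| ≤ c := fun x y => by
      rw [hFdef]
      simp only
      rw [← integral_sub (hint x) (hint y)]
      have := norm_integral_le_of_norm_le_const (μ := ν)
        (f := fun z => f (e (x, z)) - f (e (y, z))) (C := c)
        (Filter.Eventually.of_forall fun z => by
          have := hd (e (x, z)) 0 y
          simp only [hcons, Fin.update_cons_zero] at this ⊢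
          exact this)
      simpa using this
    have hin : ∀ x, ∫ y, Real.exp (t * f (e (x, y))) ∂ν
        ≤ Real.exp (n * (t ^ 2 * c ^ 2 / 8)) * Real.exp (t * F x) := fun x => by
      rw [← Real.exp_add, add_comm (n * (t ^ 2 * c ^ 2 / 8)) _]
      refine ih (fun y => f (e (x, y))) (hfe.comp measurable_prodMk_left) ⟨C, fun y => hC _⟩
        (fun z i y => ?_) t
      have := hd (e (x, z)) i.succ y
      simp only [hcons] at this ⊢
      rwa [← Fin.cons_update] at this
    obtain ⟨D, hD⟩ := hexpb
    calc ∫ x, ∫ y, Real.exp (t * f (e (x, y))) ∂ν ∂μ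
        ≤ ∫ x, Real.exp (n * (t ^ 2 * c ^ 2 / 8)) * Real.exp (t * F x) ∂μ := by
          refine integral_mono ?_ ?_ hin
          · have : Integrable (fun p : E × (Fin n → E) => Real.exp (t * f (e p))) (μ.prod ν) :=
              Integrable.of_bound (hfe.const_mul t).exp.aestronglyMeasurable D
                (Filter.Eventually.of_forall fun p => hD _)
            exact this.integral_prod_left
          · refine Integrable.const_mul ?_ _
            refine Integrable.of_bound (by fun_prop) (Real.exp (|t| * C))
              (Filter.Eventually.of_forall fun x => ?_)
            rw [Real.norm_of_nonneg (Real.exp_pos _).le]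
            refine Real.exp_le_exp.2 ((le_abs_self _).trans ?_)
            rw [abs_mul]
            exact mul_le_mul_of_nonneg_left (hFC x) (abs_nonneg _)
      _ = Real.exp (n * (t ^ 2 * c ^ 2 / 8)) * ∫ x, Real.exp (t * F x) ∂μ :=
          integral_const_mul _ _
      _ ≤ Real.exp (n * (t ^ 2 * c ^ 2 / 8))
            * Real.exp (t * ∫ x, F x ∂μ + t ^ 2 * c ^ 2 / 8) := by
          gcongr
          exact integral_exp_le_of_oscillation hFm hFC hosc t
      _ = _ := by
          rw [← Real.exp_add]
          push_cast
          ring_nf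

/-- **McDiarmid's inequality** for differences bounded by `2 / n`. -/
lemma measure_pi_ge_le_of_bounded_differences {n : ℕ} (hn : 1 ≤ n) {f : (Fin n → E) → ℝ}
    (hf : Measurable f) {C : ℝ} (hC : ∀ x, |f x| ≤ C)
    (hd : ∀ x i y, |f x - f (Function.update x i y)| ≤ 2 / n) {s : ℝ} (hs : 0 ≤ s) :
    (Measure.pi fun _ : Fin n => μ)
        {x | (∫ y, f y ∂(Measure.pi fun _ : Fin n => μ)) + s ≤ f x}
      ≤ ENNReal.ofReal (Real.exp (-(n * s ^ 2 / 2))) := by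
  have hn0 : (0 : ℝ) < n := by exact_mod_cast hn
  set ν := Measure.pi fun _ : Fin n => μ
  -- The parameter `t = n s` minimizes `-t s + n t² (2/n)² / 8 = -t s + t²/(2n)`.
  have h1 := measure_ge_le_exp_mul_mgf (μ := ν) (X := f) ((∫ y, f y ∂ν) + s)
    (by positivity : 0 ≤ n * s) (by
      refine Integrable.of_bound (by fun_prop) (Real.exp (n * s * C))
        (Filter.Eventually.of_forall fun x => ?_)
      rw [Real.norm_of_nonneg (Real.exp_pos _).le]
      exact Real.exp_le_exp.2 (mul_le_mul_of_nonneg_left ((le_abs_self _).trans (hC x))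
        (by positivity)))
  have h2 := integral_pi_exp_le_of_bounded_differences (μ := μ) n f hf ⟨C, hC⟩ hd (n * s)
  have h4 : ν.real {x | (∫ y, f y ∂ν) + s ≤ f x} ≤ Real.exp (-(n * s ^ 2 / 2)) := by
    refine h1.trans ((mul_le_mul_of_nonneg_left h2 (Real.exp_pos _).le).trans (le_of_eq ?_))
    rw [← Real.exp_add]
    congr 1
    field_simp
    ring
  rw [Measure.real] at h4
  exact (ENNReal.le_ofReal_iff_toReal_le (measure_ne_top _ _) (Real.exp_pos _).le).2 h4

end Concentration

/-! ### Gaussian moments and Gaussian tilting -/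

section GaussianMoments

open scoped NNReal ENNReal

lemma integrable_pow_gaussianReal (v : ℝ≥0) (k : ℕ) :
    Integrable (fun x : ℝ => x ^ k) (gaussianReal 0 v) := by
  have h := (memLp_id_gaussianReal (μ := 0) (v := v) (k : ℝ≥0)).integrable_norm_pow'
  refine h.mono' (by fun_prop) (Filter.Eventually.of_forall fun x => ?_)
  simp

/-- Integration by parts (Stein's identity): the derivative of the density times `x ^ (k + 1)`
integrates to zero. -/
lemma integral_pow_add_two_gaussianReal {v : ℝ≥0} (hv : v ≠ 0) (k : ℕ) :
    ∫ x, x ^ (k + 2) ∂gaussianReal 0 v = (k + 1) * v * ∫ x, x ^ k ∂gaussianReal 0 v := by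
  have hv' : (v : ℝ) ≠ 0 := by exact_mod_cast hv
  have hint : ∀ j : ℕ, Integrable fun x : ℝ => gaussianPDFReal 0 v x * x ^ j := fun j => by
    have h := integrable_pow_gaussianReal v j
    rw [gaussianReal_of_var_ne_zero 0 hv, integrable_withDensity_iff_integrable_smul'
      (measurable_gaussianPDF 0 v) (Filter.Eventually.of_forall fun x => gaussianPDF_lt_top)] at h
    simpa [toReal_gaussianPDF] using h
  have hd : ∀ x : ℝ, HasDerivAt (fun x => gaussianPDFReal 0 v x * x ^ (k + 1))
      ((k + 1) * (gaussianPDFReal 0 v x * x ^ k)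
        - (v : ℝ)⁻¹ * (gaussianPDFReal 0 v x * x ^ (k + 2))) x := fun x => by
    have h1 : HasDerivAt (fun x => gaussianPDFReal 0 v x)
        (gaussianPDFReal 0 v x * (-(x / v))) x := by
      simp only [gaussianPDFReal_def, sub_zero]
      have h2 : HasDerivAt (fun x : ℝ => -x ^ 2 / (2 * v)) (-(x / v)) x := by
        refine (((hasDerivAt_pow 2 x).neg).div_const (2 * (v : ℝ))).congr_deriv ?_
        push_cast
        field_simp
      refine (h2.exp.const_mul (√(2 * Real.pi * v))⁻¹).congr_deriv ?_
      ring
    refine (h1.mul (hasDerivAt_pow (k + 1) x)).congr_deriv ?_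
    push_cast
    field_simp
    ring
  have h0 := integral_eq_zero_of_hasDerivAt_of_integrable hd
    (((hint k).const_mul _).sub ((hint (k + 2)).const_mul _)) (hint (k + 1))
  rw [integral_sub ((hint k).const_mul _) ((hint (k + 2)).const_mul _), integral_const_mul,
    integral_const_mul] at h0
  rw [integral_gaussianReal_eq_integral_smul hv, integral_gaussianReal_eq_integral_smul hv]
  simp only [smul_eq_mul]
  field_simp at h0
  linarith

lemma integral_sq_pow_gaussianReal {v : ℝ≥0} (hv : v ≠ 0) :
    ∫ x, (x ^ 2) ^ 1 ∂gaussianReal 0 v = v ∧ ∫ x, (x ^ 2) ^ 2 ∂gaussianReal 0 v = 3 * v ^ 2 ∧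
    ∫ x, (x ^ 2) ^ 3 ∂gaussianReal 0 v = 15 * v ^ 3 ∧
    ∫ x, (x ^ 2) ^ 4 ∂gaussianReal 0 v = 105 * v ^ 4 := by
  have h0 := integral_pow_add_two_gaussianReal hv 0
  have h2 := integral_pow_add_two_gaussianReal hv 2
  have h4 := integral_pow_add_two_gaussianReal hv 4
  have h6 := integral_pow_add_two_gaussianReal hv 6
  simp only [← pow_mul]
  norm_num at h0 h2 h4 h6 ⊢
  rw [h6, h4, h2, h0]
  refine ⟨rfl, ?_, ?_, ?_⟩ <;> ring

/-- The exponents add, `1/(2v) + c = (1 + 2cv)/(2v)`, and the two normalizing constants differ by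
the factor `√(1 + 2cv)`. -/
lemma withDensity_exp_neg_sq_gaussianReal {v : ℝ≥0} (hv : v ≠ 0) {c : ℝ} (hc : 0 ≤ c) :
    (gaussianReal 0 v).withDensity (fun x => ENNReal.ofReal (Real.exp (-(c * x ^ 2))))
      = ENNReal.ofReal (√(1 + 2 * c * v))⁻¹ •
        gaussianReal 0 (v / (1 + 2 * c * v)).toNNReal := by
  have hv' : (0 : ℝ) < v := by positivity
  have hp : 0 < 1 + 2 * c * v := by positivity
  have hv2 : 0 < v / (1 + 2 * c * v) := by positivity
  have hne : (v / (1 + 2 * c * v)).toNNReal ≠ 0 := by simpa using hv2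
  rw [gaussianReal_of_var_ne_zero 0 hv, gaussianReal_of_var_ne_zero 0 hne,
    ← withDensity_smul _ (measurable_gaussianPDF _ _),
    ← withDensity_mul _ (measurable_gaussianPDF _ _) (by fun_prop)]
  congr 1
  funext x
  simp only [Pi.mul_apply, Pi.smul_apply, smul_eq_mul, gaussianPDF]
  rw [← ENNReal.ofReal_mul (gaussianPDFReal_nonneg _ _ _), ← ENNReal.ofReal_mul (by positivity)]
  congr 1
  simp only [gaussianPDFReal, sub_zero, Real.coe_toNNReal _ hv2.le]
  have h1 : √(2 * Real.pi * v)
      = √(1 + 2 * c * v) * √(2 * Real.pi * (v / (1 + 2 * c * v))) := by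
    rw [← Real.sqrt_mul hp.le]
    congr 1
    field_simp
  rw [h1, mul_inv, mul_assoc, mul_assoc, ← Real.exp_add]
  congr 3
  field_simp
  ring

variable {ι : Type*} [Fintype ι]

/-- It suffices to compare on boxes, where the indicator is itself a product and independence of the
coordinates factors the integral. -/
lemma pi_withDensity_prod {μ : ι → Measure ℝ} [∀ i, IsProbabilityMeasure (μ i)]
    {g : ι → ℝ → ℝ≥0∞} (hg : ∀ i, Measurable (g i)) [∀ i, SigmaFinite ((μ i).withDensity (g i))] :
    (Measure.pi μ).withDensity (fun w => ∏ i, g i (w i))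
      = Measure.pi fun i => (μ i).withDensity (g i) := by
  symm
  refine Measure.pi_eq fun s hs => ?_
  rw [withDensity_apply _ (MeasurableSet.univ_pi hs), ← lintegral_indicator (MeasurableSet.univ_pi hs)]
  have h1 : (Set.univ.pi s).indicator (fun w : ι → ℝ => ∏ i, g i (w i))
      = fun w => ∏ i, (s i).indicator (g i) (w i) := by
    funext w
    by_cases hw : w ∈ Set.univ.pi s
    · rw [Set.indicator_of_mem hw]
      exact Finset.prod_congr rfl fun i _ => (Set.indicator_of_mem (hw i trivial) _).symm
    · rw [Set.indicator_of_notMem hw]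
      simp only [Set.mem_pi, not_forall] at hw
      obtain ⟨i, _, hi⟩ := hw
      exact (Finset.prod_eq_zero (Finset.mem_univ i) (Set.indicator_of_notMem hi _)).symm
  have hgm : ∀ i, Measurable ((s i).indicator (g i)) := fun i => (hg i).indicator (hs i)
  rw [h1]
  have hind := iIndepFun_pi (μ := μ) (X := fun i => (s i).indicator (g i))
    fun i => (hgm i).aemeasurable
  have h2 := lintegral_prod_eq_prod_lintegral_of_indepFun Finset.univ _ hind
    fun i => (hgm i).comp (measurable_pi_apply i)
  refine Eq.trans ?_ (h2.trans ?_)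
  · refine lintegral_congr fun w => ?_
    simp
  · refine Finset.prod_congr rfl fun i _ => ?_
    rw [withDensity_apply _ (hs i), ← lintegral_indicator (hs i)]
    exact (measurePreserving_eval μ i).lintegral_comp (hgm i)

/-- Multiplying a centered product Gaussian by a Gaussian weight gives a multiple of a centered
product Gaussian. -/
lemma integral_exp_neg_sum_sq_mul {v : ℝ≥0} (hv : v ≠ 0) {c : ι → ℝ} (hc : ∀ i, 0 ≤ c i)
    (F : (ι → ℝ) → ℝ) :
    ∫ w, Real.exp (-∑ i, c i * w i ^ 2) * F w ∂(Measure.pi fun _ => gaussianReal 0 v)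
      = (∏ i, (√(1 + 2 * c i * v))⁻¹) * ∫ w, F w
          ∂(Measure.pi fun i => gaussianReal 0 (v / (1 + 2 * c i * v)).toNNReal) := by
  have h1 : ∀ i, (gaussianReal 0 v).withDensity
      (fun x => ENNReal.ofReal (Real.exp (-(c i * x ^ 2)))) = _ := fun i =>
    withDensity_exp_neg_sq_gaussianReal hv (hc i)
  have hsf : ∀ i, SigmaFinite ((gaussianReal 0 v).withDensity
      (fun x => ENNReal.ofReal (Real.exp (-(c i * x ^ 2))))) := fun i => by
    have := isFiniteMeasure_withDensity_ofReal (μ := gaussianReal 0 v)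
      (f := fun x => Real.exp (-(c i * x ^ 2))) ?_
    · infer_instance
    · exact (Integrable.of_bound (C := 1) (by fun_prop) (Filter.Eventually.of_forall fun x => by
        rw [Real.norm_of_nonneg (Real.exp_pos _).le, Real.exp_le_one_iff]
        nlinarith [hc i, mul_nonneg (hc i) (sq_nonneg x)])).2
  have h2 := pi_withDensity_prod (μ := fun _ : ι => gaussianReal 0 v)
    (g := fun i x => ENNReal.ofReal (Real.exp (-(c i * x ^ 2)))) (fun i => by fun_prop)
  have h3 : (Measure.pi fun i => (gaussianReal 0 v).withDensity
      (fun x => ENNReal.ofReal (Real.exp (-(c i * x ^ 2)))))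
      = ENNReal.ofReal (∏ i, (√(1 + 2 * c i * v))⁻¹) •
        Measure.pi fun i => gaussianReal 0 (v / (1 + 2 * c i * v)).toNNReal := by
    refine Measure.pi_eq fun s hs => ?_
    simp only [h1, Measure.smul_apply, smul_eq_mul, Measure.pi_pi]
    rw [Finset.prod_mul_distrib, ENNReal.ofReal_prod_of_nonneg fun i _ => by positivity]
  rw [h3] at h2
  have hdens : (fun w : ι → ℝ => ∏ i, ENNReal.ofReal (Real.exp (-(c i * w i ^ 2))))
      = fun w => ENNReal.ofReal (Real.exp (-∑ i, c i * w i ^ 2)) := by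
    funext w
    rw [← ENNReal.ofReal_prod_of_nonneg fun i _ => (Real.exp_pos _).le, ← Real.exp_sum,
      Finset.sum_neg_distrib]
  rw [hdens] at h2
  have hZ : 0 ≤ ∏ i, (√(1 + 2 * c i * v))⁻¹ := Finset.prod_nonneg fun i _ => by positivity
  have h4 : ∫ w, F w ∂((Measure.pi fun _ : ι => gaussianReal 0 v).withDensity
      fun w => ENNReal.ofReal (Real.exp (-∑ i, c i * w i ^ 2)))
      = ∫ w, Real.exp (-∑ i, c i * w i ^ 2) * F w ∂(Measure.pi fun _ => gaussianReal 0 v) := by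
    rw [integral_withDensity_eq_integral_toReal_smul (by fun_prop)
      (Filter.Eventually.of_forall fun _ => ENNReal.ofReal_lt_top)]
    refine integral_congr_ae (Filter.Eventually.of_forall fun w => ?_)
    simp [ENNReal.toReal_ofReal (Real.exp_pos _).le]
  rw [← h4, h2, integral_smul_measure, ENNReal.toReal_ofReal hZ, smul_eq_mul]

lemma integral_add_pow_of_indepFun {Ω : Type*} [MeasurableSpace Ω] {P : Measure Ω}
    [IsProbabilityMeasure P] {X Y : Ω → ℝ} (hXY : IndepFun X Y P)
    (hX : ∀ k : ℕ, Integrable (fun ω => X ω ^ k) P) (hY : ∀ k : ℕ, Integrable (fun ω => Y ω ^ k) P)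
    (n : ℕ) :
    Integrable (fun ω => (X ω + Y ω) ^ n) P ∧
    ∫ ω, (X ω + Y ω) ^ n ∂P
      = ∑ k ∈ Finset.range (n + 1), (∫ ω, X ω ^ k ∂P) * (∫ ω, Y ω ^ (n - k) ∂P) * n.choose k := by
  have hind : ∀ j k : ℕ, IndepFun (fun ω => X ω ^ j) (fun ω => Y ω ^ k) P := fun j k =>
    hXY.comp (φ := fun x => x ^ j) (ψ := fun x => x ^ k) (by fun_prop) (by fun_prop)
  have hi : ∀ j k : ℕ, Integrable (fun ω => X ω ^ j * Y ω ^ k) P := fun j k =>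
    (hind j k).integrable_mul (hX j) (hY k)
  simp only [add_pow]
  refine ⟨integrable_finsetSum _ fun k _ => (hi _ _).mul_const _, ?_⟩
  rw [integral_finsetSum _ fun k _ => (hi _ _).mul_const _]
  refine Finset.sum_congr rfl fun k _ => ?_
  rw [integral_mul_const, (hind _ _).integral_fun_mul_eq_mul_integral
    (hX _).aestronglyMeasurable (hY _).aestronglyMeasurable]

/-- The moments up to order four of a diagonal quadratic form in independent centered Gaussian
variables. -/
lemma moments_quadratic_form {v : ℝ≥0} (hv : v ≠ 0) (δ : ι → ℝ) (s : Finset ι) :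
    (∀ k : ℕ, Integrable (fun w : ι → ℝ => (∑ i ∈ s, δ i * w i ^ 2) ^ k)
      (Measure.pi fun _ => gaussianReal 0 v)) ∧
    ∫ w, (∑ i ∈ s, δ i * w i ^ 2) ^ 1 ∂(Measure.pi fun _ : ι => gaussianReal 0 v)
      = v * ∑ i ∈ s, δ i ∧
    ∫ w, (∑ i ∈ s, δ i * w i ^ 2) ^ 2 ∂(Measure.pi fun _ : ι => gaussianReal 0 v)
      = v ^ 2 * (2 * ∑ i ∈ s, δ i ^ 2 + (∑ i ∈ s, δ i) ^ 2) ∧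
    ∫ w, (∑ i ∈ s, δ i * w i ^ 2) ^ 3 ∂(Measure.pi fun _ : ι => gaussianReal 0 v)
      = v ^ 3 * (8 * ∑ i ∈ s, δ i ^ 3 + 6 * (∑ i ∈ s, δ i ^ 2) * (∑ i ∈ s, δ i)
        + (∑ i ∈ s, δ i) ^ 3) ∧
    ∫ w, (∑ i ∈ s, δ i * w i ^ 2) ^ 4 ∂(Measure.pi fun _ : ι => gaussianReal 0 v)
      = v ^ 4 * (48 * ∑ i ∈ s, δ i ^ 4 + 32 * (∑ i ∈ s, δ i ^ 3) * (∑ i ∈ s, δ i)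
        + 12 * (∑ i ∈ s, δ i ^ 2) ^ 2 + 12 * (∑ i ∈ s, δ i ^ 2) * (∑ i ∈ s, δ i) ^ 2
        + (∑ i ∈ s, δ i) ^ 4) := by
  classical
  set G := Measure.pi fun _ : ι => gaussianReal 0 v with hG
  induction s using Finset.induction_on with
  | empty => simp
  | insert i s hi ih =>
    obtain ⟨hint, h1, h2, h3, h4⟩ := ih
    have hindep : iIndepFun (fun (j : ι) (w : ι → ℝ) => δ j * w j ^ 2) G :=
      iIndepFun_pi (μ := fun _ : ι => gaussianReal 0 v) (X := fun j x => δ j * x ^ 2)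
        fun j => by fun_prop
    have hpair : IndepFun (fun w : ι → ℝ => ∑ j ∈ s, δ j * w j ^ 2) (fun w => δ i * w i ^ 2) G := by
      have := hindep.indepFun_finsetSum_of_notMem (fun j => by fun_prop) hi
      convert this using 1
      ext w
      simp
    have hev := fun (f : ℝ → ℝ) (hf : AEStronglyMeasurable f (gaussianReal 0 v)) =>
      integral_comp_eval (μ := fun _ : ι => gaussianReal 0 v) (i := i) (f := f) hf
    have hYi : ∀ k : ℕ, Integrable (fun w : ι → ℝ => (δ i * w i ^ 2) ^ k) G := fun k => by
      have h : Integrable (fun x : ℝ => (δ i * x ^ 2) ^ k) (gaussianReal 0 v) := by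
        simp only [mul_pow, ← pow_mul]
        exact (integrable_pow_gaussianReal v _).const_mul _
      exact integrable_comp_eval (μ := fun _ : ι => gaussianReal 0 v) (i := i) h
    have hYm : ∀ k : ℕ, ∫ w, (δ i * w i ^ 2) ^ k ∂G
        = δ i ^ k * ∫ x, (x ^ 2) ^ k ∂gaussianReal 0 v := fun k => by
      rw [hG, hev (fun x => (δ i * x ^ 2) ^ k) (by fun_prop)]
      simp only [mul_pow]
      rw [integral_const_mul]
    obtain ⟨g1, g2, g3, g4⟩ := integral_sq_pow_gaussianReal hv
    -- With `S_k = ∑ δ i ^ k`, the form has cumulants `2^(k-1) (k-1)! v^k S_k`, and the four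
    -- formulas are the moment-cumulant relations. One more index is an independent summand, so the
    -- binomial formula propagates them.
    have key := integral_add_pow_of_indepFun hpair hint hYi
    have hrw : ∀ (k : ℕ) (w : ι → ℝ), (∑ j ∈ insert i s, δ j * w j ^ 2) ^ k
        = ((∑ j ∈ s, δ j * w j ^ 2) + δ i * w i ^ 2) ^ k := fun k w => by
      rw [Finset.sum_insert hi, add_comm]
    simp only [hrw]
    simp only [Finset.sum_insert hi]
    refine ⟨fun k => (key k).1, ?_, ?_, ?_, ?_⟩
    · rw [(key 1).2]
      simp only [Finset.sum_range_succ, Finset.sum_range_zero, hYm, h1, g1, Nat.choose,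
        Nat.sub_zero, Nat.sub_self]
      simp
      ring
    · rw [(key 2).2]
      simp only [Finset.sum_range_succ, Finset.sum_range_zero, hYm, h1, h2, g1, g2, Nat.choose,
        Nat.sub_zero, Nat.sub_self, Nat.reduceSub]
      simp
      ring
    · rw [(key 3).2]
      simp only [Finset.sum_range_succ, Finset.sum_range_zero, hYm, h1, h2, h3, g1, g2, g3,
        Nat.choose, Nat.sub_zero, Nat.sub_self, Nat.reduceSub]
      simp
      ring
    · rw [(key 4).2]
      simp only [Finset.sum_range_succ, Finset.sum_range_zero, hYm, h1, h2, h3, h4, g1, g2, g3, g4,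
        Nat.choose, Nat.sub_zero, Nat.sub_self, Nat.reduceSub]
      simp
      ring

end GaussianMoments

/-! ### Second moment against squared mean, for the variance part and the mean part -/

section MomentComparison

open scoped NNReal ENNReal

variable {ι : Type*} [Fintype ι]

/-- The modulus of the characteristic function of a Gaussian with covariance `diag s`. -/
def gaussWeight (s w : ι → ℝ) : ℝ := Real.exp (-((∑ i, s i * w i ^ 2) / 2))

lemma gaussWeight_pos (s w : ι → ℝ) : 0 < gaussWeight s w := Real.exp_pos _

lemma gaussWeight_le_one {s : ι → ℝ} (hs : ∀ i, 0 ≤ s i) (w : ι → ℝ) : gaussWeight s w ≤ 1 := by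
  rw [gaussWeight, Real.exp_le_one_iff, neg_nonpos]
  have : 0 ≤ ∑ i, s i * w i ^ 2 := Finset.sum_nonneg fun i _ => mul_nonneg (hs i) (sq_nonneg _)
  positivity

@[fun_prop]
lemma measurable_gaussWeight (s : ι → ℝ) : Measurable (gaussWeight s) := by
  unfold gaussWeight
  fun_prop

/-- Follows from `1 + x ≤ e^x`. Together with its companion below, it sandwiches a difference of
Gaussian weights between multiples of `|P - Q|` by Gaussian factors, reducing its moments to those
of a quadratic form. -/
lemma abs_exp_neg_sub_le {p q l : ℝ} (hp : l ≤ p) (hq : l ≤ q) :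
    |Real.exp (-p) - Real.exp (-q)| ≤ |p - q| * Real.exp (-l) := by
  wlog h : p ≤ q generalizing p q
  · rw [abs_sub_comm, abs_sub_comm p]
    exact this hq hp (le_of_not_ge h)
  have h1 : Real.exp (-q) = Real.exp (-p) * Real.exp (-(q - p)) := by
    rw [← Real.exp_add]; ring_nf
  have h2 := Real.add_one_le_exp (-(q - p))
  have h3 : Real.exp (-p) ≤ Real.exp (-l) := Real.exp_le_exp.2 (by linarith)
  have h4 : Real.exp (-q) ≤ Real.exp (-p) := Real.exp_le_exp.2 (by linarith)
  rw [abs_of_nonneg (by linarith), abs_of_nonpos (by linarith), h1]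
  nlinarith [Real.exp_pos (-p), mul_le_mul_of_nonneg_left h2 (Real.exp_pos (-p)).le]

lemma le_abs_exp_neg_sub {p q u : ℝ} (hp : p ≤ u) (hq : q ≤ u) :
    |p - q| * Real.exp (-u) ≤ |Real.exp (-p) - Real.exp (-q)| := by
  wlog h : p ≤ q generalizing p q
  · rw [abs_sub_comm, abs_sub_comm (Real.exp (-p))]
    exact this hq hp (le_of_not_ge h)
  have h1 : Real.exp (-p) = Real.exp (-q) * Real.exp (q - p) := by
    rw [← Real.exp_add]; ring_nf
  have h2 := Real.add_one_le_exp (q - p)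
  have h3 : Real.exp (-u) ≤ Real.exp (-q) := Real.exp_le_exp.2 (by linarith)
  have h4 : Real.exp (-q) ≤ Real.exp (-p) := Real.exp_le_exp.2 (by linarith)
  rw [abs_of_nonneg (by linarith : 0 ≤ Real.exp (-p) - Real.exp (-q)),
    abs_of_nonpos (by linarith), h1]
  nlinarith [Real.exp_pos (-q), mul_le_mul_of_nonneg_left h2 (Real.exp_pos (-q)).le]

/-- Hypercontractivity in degree two, `E Q⁴ ≤ 18 (E Q²)²` for the quadratic form `Q = ∑ δ i * w i ^
2`, whatever the signs of the `δ i`. The power sums of order three and four are absorbed by those of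
order one and two. -/
lemma fourth_moment_le (δ : ι → ℝ) :
    48 * ∑ i, δ i ^ 4 + 32 * (∑ i, δ i ^ 3) * (∑ i, δ i) + 12 * (∑ i, δ i ^ 2) ^ 2
      + 12 * (∑ i, δ i ^ 2) * (∑ i, δ i) ^ 2 + (∑ i, δ i) ^ 4
      ≤ 18 * (2 * ∑ i, δ i ^ 2 + (∑ i, δ i) ^ 2) ^ 2 := by
  have h4 : ∑ i, δ i ^ 4 ≤ (∑ i, δ i ^ 2) ^ 2 := by
    have := Finset.sum_sq_le_sq_sum_of_nonneg (s := Finset.univ) (f := fun i => δ i ^ 2)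
      fun i _ => sq_nonneg _
    simpa [← pow_mul] using this
  have h3 : (∑ i, δ i ^ 3) ^ 2 ≤ (∑ i, δ i ^ 2) * ∑ i, δ i ^ 4 := by
    have := Finset.sum_mul_sq_le_sq_mul_sq Finset.univ δ (fun i => δ i ^ 2)
    simpa [← pow_mul, ← pow_succ'] using this
  have h2 : 0 ≤ ∑ i, δ i ^ 2 := Finset.sum_nonneg fun i _ => sq_nonneg _
  set S1 := ∑ i, δ i
  set S2 := ∑ i, δ i ^ 2
  set S3 := ∑ i, δ i ^ 3
  set S4 := ∑ i, δ i ^ 4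
  -- From `S3² ≤ S2³` and the arithmetic-geometric mean: `(2 S3 S1)² ≤ 4 (S2²/2)(2 S2 S1²)`.
  have h5 : 2 * (S3 * S1) ≤ S2 ^ 2 / 2 + 2 * (S2 * S1 ^ 2) := by
    refine le_of_abs_le (abs_le_of_sq_le_sq ?_ (by positivity))
    have h6 : S3 ^ 2 ≤ S2 ^ 3 := h3.trans (by nlinarith)
    nlinarith [mul_le_mul_of_nonneg_right h6 (sq_nonneg S1), sq_nonneg (S2 ^ 2 / 2 - 2 * (S2 * S1 ^ 2))]
  nlinarith [sq_nonneg (S1 ^ 2), mul_nonneg h2 (sq_nonneg S1), sq_nonneg S2]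

/-- Both exponents lie between `l |w|²/2` and `u |w|²/2`. Comparing with these extremes leaves the
moments of one form `Q` under two tilted Gaussians, and the ratio of the tilts is the constant. -/
lemma integral_gaussWeight_sub_pow_four_le {v : ℝ≥0} (hv : v ≠ 0) {s t : ι → ℝ} {l u : ℝ}
    (hl : 0 ≤ l) (hs : ∀ i, s i ∈ Set.Icc l u) (ht : ∀ i, t i ∈ Set.Icc l u) (hlu : l ≤ u) :
    ∫ w, ((gaussWeight s w - gaussWeight t w) ^ 2) ^ 2 ∂(Measure.pi fun _ => gaussianReal 0 v)
      ≤ 18 * (1 + 2 * u * v) ^ (Fintype.card ι + 4) / (1 + 4 * l * v) ^ 4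
        * (∫ w, (gaussWeight s w - gaussWeight t w) ^ 2
            ∂(Measure.pi fun _ => gaussianReal 0 v)) ^ 2 := by
  set G := Measure.pi fun _ : ι => gaussianReal 0 v with hG
  set δ : ι → ℝ := fun i => s i - t i with hδ
  set Q : (ι → ℝ) → ℝ := fun w => ∑ i, δ i * w i ^ 2 with hQ
  set M2 := 2 * ∑ i, δ i ^ 2 + (∑ i, δ i) ^ 2 with hM2
  have hv0 : (0 : ℝ) < v := by positivity
  have hu : 0 ≤ u := hl.trans hlu
  have hs0 : ∀ i, 0 ≤ s i := fun i => hl.trans (hs i).1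
  have ht0 : ∀ i, 0 ≤ t i := fun i => hl.trans (ht i).1
  have hM20 : 0 ≤ M2 := by
    have : 0 ≤ ∑ i, δ i ^ 2 := Finset.sum_nonneg fun i _ => sq_nonneg _
    positivity
  have hdiff : ∀ w : ι → ℝ, |(∑ i, s i * w i ^ 2) / 2 - (∑ i, t i * w i ^ 2) / 2| = |Q w| / 2 := by
    intro w
    rw [← sub_div, ← Finset.sum_sub_distrib, abs_div, abs_two, hQ]
    simp only [hδ, sub_mul]
  have hmono : ∀ (a b : ι → ℝ), (∀ i, a i ≤ b i) → ∀ w : ι → ℝ,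
      (∑ i, a i * w i ^ 2) / 2 ≤ (∑ i, b i * w i ^ 2) / 2 := fun a b hab w => by
    gcongr with i _
    exact hab i
  -- The square of `e^{-u|w|²/2}` tilts at rate `u`. For the upper bound, the fourth power of
  -- `e^{-l|w|²/2}` tilts at rate `2l`.
  have hlow : ∀ w, Real.exp (-∑ i, u * w i ^ 2) * (1 / 4 * Q w ^ 2)
      ≤ (gaussWeight s w - gaussWeight t w) ^ 2 := fun w => by
    have h := le_abs_exp_neg_sub (hmono s (fun _ => u) (fun i => (hs i).2) w)
      (hmono t (fun _ => u) (fun i => (ht i).2) w)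
    have h2 := pow_le_pow_left₀ (by positivity) h 2
    rw [sq_abs, hdiff, mul_pow, ← Real.exp_nat_mul, div_pow, sq_abs] at h2
    refine le_trans (le_of_eq ?_) h2
    rw [mul_comm]
    congr 1
    · ring
    · congr 1; push_cast; ring
  have hup : ∀ w, ((gaussWeight s w - gaussWeight t w) ^ 2) ^ 2
      ≤ Real.exp (-∑ i, 2 * l * w i ^ 2) * (1 / 16 * Q w ^ 4) := fun w => by
    have h := abs_exp_neg_sub_le (hmono (fun _ => l) s (fun i => (hs i).1) w)
      (hmono (fun _ => l) t (fun i => (ht i).1) w)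
    have h2 := pow_le_pow_left₀ (abs_nonneg _) h 4
    rw [hdiff, mul_pow, ← Real.exp_nat_mul, div_pow, Even.pow_abs (by decide),
      Even.pow_abs (by decide)] at h2
    rw [← pow_mul]
    refine h2.trans (le_of_eq ?_)
    rw [mul_comm]
    congr 1
    · congr 1
      simp only [mul_assoc, ← Finset.mul_sum]; push_cast; ring
    · ring
  have hmom := moments_quadratic_form hv δ Finset.univ
  have hexp1 : ∀ c : ℝ, 0 ≤ c → ∀ w : ι → ℝ, Real.exp (-∑ i, c * w i ^ 2) ≤ 1 := fun c hc w => by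
    rw [Real.exp_le_one_iff, neg_nonpos]
    exact Finset.sum_nonneg fun i _ => mul_nonneg hc (sq_nonneg _)
  have hint : ∀ (c : ℝ), 0 ≤ c → ∀ (r : ℝ) (k : ℕ), Integrable
      (fun w => Real.exp (-∑ i, c * w i ^ 2) * (r * Q w ^ k)) G := fun c hc r k => by
    refine ((hmom.1 k).const_mul r).bdd_mul (c := 1)
      (Measurable.aestronglyMeasurable (by fun_prop))
      (Filter.Eventually.of_forall fun w => ?_)
    rw [Real.norm_of_nonneg (Real.exp_pos _).le]
    exact hexp1 c hc w
  have hb : ∀ w, (gaussWeight s w - gaussWeight t w) ^ 2 ≤ 1 := fun w => by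
    rw [sq_le_one_iff_abs_le_one, abs_le]
    constructor <;> linarith [gaussWeight_pos s w, gaussWeight_pos t w, gaussWeight_le_one hs0 w,
      gaussWeight_le_one ht0 w]
  have hRi : Integrable (fun w => (gaussWeight s w - gaussWeight t w) ^ 2) G :=
    Integrable.of_bound (Measurable.aestronglyMeasurable (by fun_prop)) 1 (Filter.Eventually.of_forall fun w => by
      rw [Real.norm_of_nonneg (sq_nonneg _)]; exact hb w)
  have hR2i : Integrable (fun w => ((gaussWeight s w - gaussWeight t w) ^ 2) ^ 2) G :=
    Integrable.of_bound (Measurable.aestronglyMeasurable (by fun_prop)) 1 (Filter.Eventually.of_forall fun w => by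
      rw [Real.norm_of_nonneg (sq_nonneg _)]; exact pow_le_one₀ (sq_nonneg _) (hb w))
  have htilt : ∀ (c : ℝ), 0 ≤ c → ∀ (r : ℝ) (k : ℕ),
      ∫ w, Real.exp (-∑ i, c * w i ^ 2) * (r * Q w ^ k) ∂G
      = (√(1 + 2 * c * v))⁻¹ ^ Fintype.card ι * (r * ∫ w, Q w ^ k
        ∂(Measure.pi fun _ : ι => gaussianReal 0 (v / (1 + 2 * c * v)).toNNReal)) :=
    fun c hc r k => by
      rw [hG, integral_exp_neg_sum_sq_mul hv (c := fun _ => c) (fun _ => hc), integral_const_mul]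
      simp
  have hne : ∀ c : ℝ, 0 ≤ c → (v / (1 + 2 * c * v)).toNNReal ≠ 0 := fun c hc => by
    have : 0 < v / (1 + 2 * c * v) := by positivity
    simpa using this
  have hcoe : ∀ c : ℝ, 0 ≤ c → ((v / (1 + 2 * c * v)).toNNReal : ℝ) = v / (1 + 2 * c * v) :=
    fun c hc => Real.coe_toNNReal _ (by positivity)
  have hE1 : (√(1 + 2 * u * v))⁻¹ ^ Fintype.card ι * (1 / 4 * ((v / (1 + 2 * u * v)) ^ 2 * M2))
      ≤ ∫ w, (gaussWeight s w - gaussWeight t w) ^ 2 ∂G := by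
    refine le_trans (le_of_eq ?_) (integral_mono (hint u hu (1 / 4) 2) hRi hlow)
    rw [htilt u hu, (moments_quadratic_form (hne u hu) δ Finset.univ).2.2.1, hcoe u hu]
  have hE2 : ∫ w, ((gaussWeight s w - gaussWeight t w) ^ 2) ^ 2 ∂G
      ≤ 1 / 16 * ((v / (1 + 4 * l * v)) ^ 4 * (18 * M2 ^ 2)) := by
    refine (integral_mono hR2i (hint (2 * l) (by positivity) (1 / 16) 4) hup).trans ?_
    rw [htilt (2 * l) (by positivity),
      (moments_quadratic_form (hne (2 * l) (by positivity)) δ Finset.univ).2.2.2.2,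
      hcoe (2 * l) (by positivity), show 1 + 2 * (2 * l) * (v : ℝ) = 1 + 4 * l * v by ring]
    -- The normalizing factor of the upper tilt is merely bounded by one; that of the lower tilt
    -- supplies the power `Fintype.card ι` in the constant.
    have hz : (√(1 + 4 * l * v))⁻¹ ^ Fintype.card ι ≤ 1 := by
      refine pow_le_one₀ (by positivity) (inv_le_one_of_one_le₀ ?_)
      rw [Real.one_le_sqrt]
      nlinarith [mul_nonneg hl hv0.le]
    have h18 := fourth_moment_le δ
    refine (mul_le_mul_of_nonneg_left (mul_le_mul_of_nonneg_left
      (mul_le_mul_of_nonneg_left h18 (by positivity)) (by norm_num)) (by positivity)).trans ?_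
    exact mul_le_of_le_one_left (by positivity) hz
  refine hE2.trans ?_
  have hp : 0 < 1 + 2 * u * v := by positivity
  have hq : 0 < 1 + 4 * l * v := by positivity
  have hsq : ((√(1 + 2 * u * v))⁻¹ ^ Fintype.card ι) ^ 2 = ((1 + 2 * u * v) ^ Fintype.card ι)⁻¹ := by
    rw [← pow_mul, mul_comm (Fintype.card ι) 2, pow_mul, inv_pow, Real.sq_sqrt hp.le, inv_pow]
  have := pow_le_pow_left₀ (by positivity) hE1 2
  rw [mul_pow, hsq] at this
  refine le_trans (le_of_eq ?_) (mul_le_mul_of_nonneg_left this (by positivity))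
  rw [pow_add]
  field_simp
  ring

lemma integral_cos_sum {v : ι → ℝ≥0} (ν : ι → ℝ) :
    ∫ w, Real.cos (∑ i, ν i * w i) ∂(Measure.pi fun i => gaussianReal 0 (v i))
      = Real.exp (-(∑ i, v i * ν i ^ 2) / 2) := by
  have h1 : ∫ w, Complex.exp ((∑ i, ν i * w i : ℝ) * Complex.I)
      ∂(Measure.pi fun i => gaussianReal 0 (v i))
      = (Real.exp (-(∑ i, v i * ν i ^ 2) / 2) : ℝ) := by
    have h2 : ∀ w : ι → ℝ, Complex.exp ((∑ i, ν i * w i : ℝ) * Complex.I)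
        = ∏ i, Complex.exp ((ν i : ℂ) * (w i : ℂ) * Complex.I) := fun w => by
      rw [← Complex.exp_sum]
      push_cast
      rw [Finset.sum_mul]
    simp only [h2]
    rw [integral_fintype_prod_eq_prod (fun i (x : ℝ) => Complex.exp ((ν i : ℂ) * x * Complex.I))]
    simp only [← charFun_apply_real, charFun_gaussianReal]
    rw [← Complex.exp_sum]
    push_cast
    congr 1
    rw [neg_div, Finset.sum_div, ← Finset.sum_neg_distrib]
    refine Finset.sum_congr rfl fun i _ => ?_
    ring
  have h3 : Integrable (fun w : ι → ℝ => Complex.exp ((∑ i, ν i * w i : ℝ) * Complex.I))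
      (Measure.pi fun i => gaussianReal 0 (v i)) :=
    Integrable.of_bound (Measurable.aestronglyMeasurable (by fun_prop)) 1 (Filter.Eventually.of_forall fun w => by
      rw [Complex.norm_exp_ofReal_mul_I])
  have h4 := integral_re h3
  rw [h1] at h4
  simpa only [RCLike.re_to_complex, Complex.exp_ofReal_mul_I_re, Complex.ofReal_re] using h4

/-- The product of the two weights tilts to a Gaussian of total mass `Z`, under which the cosine has
mean `q ∈ [0, 1]`. Both moments become polynomials in `q` with a double zero of the second one at `q
= 1`, and `1/Z ≤ (1 + 2uv)^{card/2}`. -/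
lemma integral_sq_gaussWeight_mul_one_sub_cos_le {v : ℝ≥0} (hv : v ≠ 0) {s t : ι → ℝ} {u : ℝ}
    (hs0 : ∀ i, 0 ≤ s i) (ht0 : ∀ i, 0 ≤ t i) (hs : ∀ i, s i ≤ u) (ht : ∀ i, t i ≤ u)
    (ν : ι → ℝ) :
    ∫ w, (2 * gaussWeight s w * gaussWeight t w * (1 - Real.cos (∑ i, ν i * w i))) ^ 2
        ∂(Measure.pi fun _ => gaussianReal 0 v)
      ≤ 3 * (√(1 + 2 * u * v)) ^ Fintype.card ι
        * (∫ w, 2 * gaussWeight s w * gaussWeight t w * (1 - Real.cos (∑ i, ν i * w i))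
            ∂(Measure.pi fun _ => gaussianReal 0 v)) ^ 2 := by
  set G := Measure.pi fun _ : ι => gaussianReal 0 v with hG
  set c : ι → ℝ := fun i => (s i + t i) / 2 with hc
  have hc0 : ∀ i, 0 ≤ c i := fun i => by have := hs0 i; have := ht0 i; simp only [hc]; positivity
  set G' := Measure.pi fun i => gaussianReal 0 (v / (1 + 2 * c i * v)).toNNReal with hG'
  set Z := ∏ i, (√(1 + 2 * c i * v))⁻¹ with hZ
  have hprod : ∀ w, gaussWeight s w * gaussWeight t w = Real.exp (-∑ i, c i * w i ^ 2) := fun w => by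
    rw [gaussWeight, gaussWeight, ← Real.exp_add]
    congr 1
    rw [← neg_add, ← add_div, ← Finset.sum_add_distrib, Finset.sum_div]
    congr 1
    refine Finset.sum_congr rfl fun i _ => ?_
    simp only [hc]
    ring
  set q := Real.exp (-(∑ i, ((v / (1 + 2 * c i * v)).toNNReal : ℝ) * ν i ^ 2) / 2) with hq
  have hcos1 : ∫ w, Real.cos (∑ i, ν i * w i) ∂G' = q := integral_cos_sum ν
  -- Doubling the frequency multiplies the Gaussian exponent by four.
  have hcos2 : ∫ w, Real.cos (2 * ∑ i, ν i * w i) ∂G' = q ^ 4 := by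
    have := integral_cos_sum (v := fun i => (v / (1 + 2 * c i * v)).toNNReal) (fun i => 2 * ν i)
    have h2 : ∀ w : ι → ℝ, ∑ i, 2 * ν i * w i = 2 * ∑ i, ν i * w i := fun w => by
      rw [Finset.mul_sum]
      exact Finset.sum_congr rfl fun i _ => mul_assoc _ _ _
    simp only [h2] at this
    rw [hG', this, hq, ← Real.exp_nat_mul]
    congr 1
    push_cast
    rw [neg_div, neg_div, Finset.sum_div, Finset.sum_div, mul_neg, Finset.mul_sum]
    congr 1
    refine Finset.sum_congr rfl fun i _ => ?_
    ring
  have hbi : ∀ f : (ι → ℝ) → ℝ, Measurable f → (∀ w, |f w| ≤ 4) →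
      ∀ (μ : Measure (ι → ℝ)) [IsFiniteMeasure μ], Integrable f μ := fun f hf hb μ _ =>
    Integrable.of_bound hf.aestronglyMeasurable 4 (Filter.Eventually.of_forall hb)
  have hci1 : Integrable (fun w : ι → ℝ => Real.cos (∑ i, ν i * w i)) G' :=
    hbi _ (by fun_prop) (fun w => (Real.abs_cos_le_one _).trans (by norm_num)) _
  have hci2 : Integrable (fun w : ι → ℝ => Real.cos (2 * ∑ i, ν i * w i)) G' :=
    hbi _ (by fun_prop) (fun w => (Real.abs_cos_le_one _).trans (by norm_num)) _
  have hE1 : ∫ w, 2 * gaussWeight s w * gaussWeight t w * (1 - Real.cos (∑ i, ν i * w i)) ∂G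
      = 2 * Z * (1 - q) := by
    have : ∀ w, 2 * gaussWeight s w * gaussWeight t w * (1 - Real.cos (∑ i, ν i * w i))
        = Real.exp (-∑ i, c i * w i ^ 2) * (2 * (1 - Real.cos (∑ i, ν i * w i))) := fun w => by
      rw [← hprod]; ring
    simp only [this]
    rw [hG, integral_exp_neg_sum_sq_mul hv hc0, integral_const_mul,
      integral_sub (integrable_const _) hci1, hcos1, integral_const, probReal_univ, one_smul]
    ring
  have hE2 : ∫ w, (2 * gaussWeight s w * gaussWeight t w * (1 - Real.cos (∑ i, ν i * w i))) ^ 2 ∂G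
      ≤ Z * (4 * (3 / 2 - 2 * q + q ^ 4 / 2)) := by
    have hle : ∀ w, (2 * gaussWeight s w * gaussWeight t w * (1 - Real.cos (∑ i, ν i * w i))) ^ 2
        ≤ Real.exp (-∑ i, c i * w i ^ 2) * (4 * (3 / 2 - 2 * Real.cos (∑ i, ν i * w i)
          + Real.cos (2 * ∑ i, ν i * w i) / 2)) := fun w => by
      rw [← hprod, Real.cos_two_mul]
      have h1 := gaussWeight_le_one hs0 w
      have h2 := gaussWeight_le_one ht0 w
      have h3 := gaussWeight_pos s w
      have h4 := gaussWeight_pos t w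
      set z := Real.cos (∑ i, ν i * w i)
      set p := gaussWeight s w * gaussWeight t w with hp
      have h5 : p ≤ 1 := mul_le_one₀ h1 h4.le h2
      have h6 : 0 < p := mul_pos h3 h4
      have h7 : 2 * gaussWeight s w * gaussWeight t w = 2 * p := by rw [hp]; ring
      rw [h7]
      -- One of the two factors `p` is discarded, so that the second moment lives on the same tilted
      -- measure as the first.
      have : (2 * p * (1 - z)) ^ 2 = p * (p * (4 * (1 - z) ^ 2)) := by ring
      rw [this]
      refine mul_le_mul_of_nonneg_left ?_ h6.le
      refine (mul_le_of_le_one_left (by positivity) h5).trans (le_of_eq ?_)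
      ring
    have hi3 : Integrable (fun w : ι → ℝ => 3 / 2 - 2 * Real.cos (∑ i, ν i * w i)) G' :=
      (integrable_const _).sub (hci1.const_mul 2)
    have heq : ∫ w, Real.exp (-∑ i, c i * w i ^ 2) * (4 * (3 / 2 - 2 * Real.cos (∑ i, ν i * w i)
          + Real.cos (2 * ∑ i, ν i * w i) / 2)) ∂G = Z * (4 * (3 / 2 - 2 * q + q ^ 4 / 2)) := by
      rw [hG, integral_exp_neg_sum_sq_mul hv hc0, integral_const_mul,
        integral_add hi3 (hci2.div_const 2),
        integral_sub (integrable_const _) (hci1.const_mul 2), integral_const_mul, hcos1,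
        integral_const, probReal_univ, one_smul, integral_div, hcos2]
    rw [← heq]
    have hcb : ∀ w : ι → ℝ, |1 - Real.cos (∑ i, ν i * w i)| ≤ 2 := fun w => by
      rw [abs_le]
      constructor <;> linarith [Real.cos_le_one (∑ i, ν i * w i),
        Real.neg_one_le_cos (∑ i, ν i * w i)]
    refine integral_mono (Integrable.of_bound (Measurable.aestronglyMeasurable (by fun_prop)) 16
      (Filter.Eventually.of_forall fun w => ?_)) ?_ hle
    · have h1 := gaussWeight_le_one hs0 w
      have h2 := gaussWeight_le_one ht0 w
      have h3 := gaussWeight_pos s w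
      have h4 := gaussWeight_pos t w
      rw [norm_pow, norm_mul, norm_mul, norm_mul, Real.norm_of_nonneg h3.le,
        Real.norm_of_nonneg h4.le, Real.norm_eq_abs, Real.norm_eq_abs, abs_two]
      calc _ ≤ (2 * 1 * 1 * 2 : ℝ) ^ 2 := by gcongr; exact hcb w
        _ = 16 := by norm_num
    · refine Integrable.of_bound (Measurable.aestronglyMeasurable (by fun_prop)) 16 (Filter.Eventually.of_forall fun w => ?_)
      have he : Real.exp (-∑ i, c i * w i ^ 2) ≤ 1 := by
        rw [Real.exp_le_one_iff, neg_nonpos]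
        exact Finset.sum_nonneg fun i _ => mul_nonneg (hc0 i) (sq_nonneg _)
      rw [norm_mul, Real.norm_of_nonneg (Real.exp_pos _).le]
      refine (mul_le_of_le_one_left (norm_nonneg _) he).trans ?_
      rw [Real.norm_eq_abs, abs_le]
      constructor <;> linarith [Real.cos_le_one (∑ i, ν i * w i),
        Real.neg_one_le_cos (∑ i, ν i * w i), Real.cos_le_one (2 * ∑ i, ν i * w i),
        Real.neg_one_le_cos (2 * ∑ i, ν i * w i)]
  have hq0 : 0 ≤ q := (Real.exp_pos _).le
  have hq1 : q ≤ 1 := by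
    rw [hq, Real.exp_le_one_iff, neg_div, neg_nonpos]
    have : 0 ≤ ∑ i, ((v / (1 + 2 * c i * v)).toNNReal : ℝ) * ν i ^ 2 :=
      Finset.sum_nonneg fun i _ => by positivity
    positivity
  have hZ0 : 0 < Z := Finset.prod_pos fun i _ => by
    have := hc0 i
    positivity
  have hZ1 : 1 ≤ (√(1 + 2 * u * v)) ^ Fintype.card ι * Z := by
    rw [hZ, ← Finset.card_univ, ← Finset.prod_const, ← Finset.prod_mul_distrib]
    rw [← Finset.prod_const_one (s := (Finset.univ : Finset ι))]
    refine Finset.prod_le_prod (fun _ _ => zero_le_one) fun i _ => ?_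
    have := hc0 i
    rw [← div_eq_mul_inv, one_le_div (by positivity)]
    refine Real.sqrt_le_sqrt ?_
    have h1 : c i ≤ u := by have := hs i; have := ht i; simp only [hc]; linarith
    gcongr
  rw [hE1]
  refine hE2.trans ?_
  -- The left side factors as `2 (1 - q)² (q² + 2q + 3)`.
  have hpoly : 4 * (3 / 2 - 2 * q + q ^ 4 / 2) ≤ 12 * (1 - q) ^ 2 := by
    nlinarith [mul_nonneg (sq_nonneg (1 - q)) (by nlinarith : 0 ≤ 3 - 2 * q - q ^ 2)]
  calc Z * (4 * (3 / 2 - 2 * q + q ^ 4 / 2)) ≤ Z * (12 * (1 - q) ^ 2) := by gcongr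
    _ = 1 * (Z * (12 * (1 - q) ^ 2)) := (one_mul _).symm
    _ ≤ ((√(1 + 2 * u * v)) ^ Fintype.card ι * Z) * (Z * (12 * (1 - q) ^ 2)) :=
      mul_le_mul_of_nonneg_right hZ1 (by positivity)
    _ = _ := by ring

end MomentComparison

/-! ### Stability under sums, and numerical bounds for the constants -/

section SecondMoment

open scoped NNReal ENNReal

lemma integral_mul_le_sqrt_mul_sqrt {Ω : Type*} [MeasurableSpace Ω] {P : Measure Ω}
    [IsFiniteMeasure P] {f g : Ω → ℝ} (hf : Measurable f) (hg : Measurable g) (hf0 : ∀ x, 0 ≤ f x)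
    (hg0 : ∀ x, 0 ≤ g x) {c : ℝ} (hfc : ∀ x, f x ≤ c) (hgc : ∀ x, g x ≤ c) :
    ∫ x, f x * g x ∂P ≤ √(∫ x, f x ^ 2 ∂P) * √(∫ x, g x ^ 2 ∂P) := by
  have h := integral_mul_le_Lp_mul_Lq_of_nonneg (μ := P) Real.HolderConjugate.two_two
    (Filter.Eventually.of_forall hf0) (Filter.Eventually.of_forall hg0)
    (MemLp.of_bound hf.aestronglyMeasurable c (Filter.Eventually.of_forall fun x => by
      rw [Real.norm_of_nonneg (hf0 x)]; exact hfc x))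
    (MemLp.of_bound hg.aestronglyMeasurable c (Filter.Eventually.of_forall fun x => by
      rw [Real.norm_of_nonneg (hg0 x)]; exact hgc x))
  rw [Real.sqrt_eq_rpow, Real.sqrt_eq_rpow]
  simpa using h

lemma integrable_of_nonneg_of_le {Ω : Type*} [MeasurableSpace Ω] {P : Measure Ω}
    [IsFiniteMeasure P] {f : Ω → ℝ} (hf : Measurable f) (hf0 : ∀ x, 0 ≤ f x) {c : ℝ}
    (hfc : ∀ x, f x ≤ c) : Integrable f P :=
  Integrable.of_bound hf.aestronglyMeasurable c (Filter.Eventually.of_forall fun x => by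
    rw [Real.norm_of_nonneg (hf0 x)]; exact hfc x)

lemma integral_add_sq {Ω : Type*} [MeasurableSpace Ω] {P : Measure Ω}
    [IsFiniteMeasure P] {f g : Ω → ℝ} (hf : Measurable f) (hg : Measurable g) (hf0 : ∀ x, 0 ≤ f x)
    (hg0 : ∀ x, 0 ≤ g x) {c : ℝ} (hfc : ∀ x, f x ≤ c) (hgc : ∀ x, g x ≤ c) :
    ∫ x, (f x + g x) ^ 2 ∂P
      = ∫ x, f x ^ 2 ∂P + 2 * ∫ x, f x * g x ∂P + ∫ x, g x ^ 2 ∂P := by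
  have h1 : Integrable (fun x => f x ^ 2) P := integrable_of_nonneg_of_le (hf.pow_const 2)
    (fun x => sq_nonneg _) fun x => pow_le_pow_left₀ (hf0 x) (hfc x) 2
  have h2 : Integrable (fun x => g x ^ 2) P := integrable_of_nonneg_of_le (hg.pow_const 2)
    (fun x => sq_nonneg _) fun x => pow_le_pow_left₀ (hg0 x) (hgc x) 2
  have h3 : Integrable (fun x => 2 * (f x * g x)) P :=
    (integrable_of_nonneg_of_le (hf.mul hg) (fun x => mul_nonneg (hf0 x) (hg0 x)) (c := c * c)
      fun x => mul_le_mul (hfc x) (hgc x) (hg0 x) ((hf0 x).trans (hfc x))).const_mul 2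
  have h4 : Integrable (fun x => f x ^ 2 + 2 * (f x * g x)) P := h1.add h3
  rw [← integral_const_mul, ← integral_add h1 h3, ← integral_add h4 h2]
  refine integral_congr_ae (Filter.Eventually.of_forall fun x => ?_)
  simp only
  ring

/-- The comparison of the second moment with the square of the first one is stable under sums. -/
lemma integral_add_sq_le {Ω : Type*} [MeasurableSpace Ω] {P : Measure Ω}
    [IsFiniteMeasure P] {f g : Ω → ℝ} (hf : Measurable f) (hg : Measurable g) (hf0 : ∀ x, 0 ≤ f x)
    (hg0 : ∀ x, 0 ≤ g x) {c : ℝ} (hfc : ∀ x, f x ≤ c) (hgc : ∀ x, g x ≤ c) {K : ℝ} (hK : 0 ≤ K)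
    (h1 : ∫ x, f x ^ 2 ∂P ≤ K * (∫ x, f x ∂P) ^ 2) (h2 : ∫ x, g x ^ 2 ∂P ≤ K * (∫ x, g x ∂P) ^ 2) :
    ∫ x, (f x + g x) ^ 2 ∂P ≤ K * (∫ x, (f x + g x) ∂P) ^ 2 := by
  have hcs := integral_mul_le_sqrt_mul_sqrt (P := P) hf hg hf0 hg0 hfc hgc
  have hA : 0 ≤ ∫ x, f x ∂P := integral_nonneg hf0
  have hB : 0 ≤ ∫ x, g x ∂P := integral_nonneg hg0
  rw [integral_add_sq hf hg hf0 hg0 hfc hgc,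
    integral_add (integrable_of_nonneg_of_le hf hf0 hfc) (integrable_of_nonneg_of_le hg hg0 hgc)]
  -- The hypotheses say that the `L²` norm is at most `√K` times the `L¹` norm. Cauchy-Schwarz on
  -- the cross term is Minkowski's inequality, and `L¹` norms of nonnegative functions add.
  have hs1 : √(∫ x, f x ^ 2 ∂P) ≤ √K * ∫ x, f x ∂P := by
    rw [← Real.sqrt_sq hA, ← Real.sqrt_mul hK]
    exact Real.sqrt_le_sqrt h1
  have hs2 : √(∫ x, g x ^ 2 ∂P) ≤ √K * ∫ x, g x ∂P := by
    rw [← Real.sqrt_sq hB, ← Real.sqrt_mul hK]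
    exact Real.sqrt_le_sqrt h2
  have hs3 := hcs.trans (mul_le_mul hs1 hs2 (Real.sqrt_nonneg _) (by positivity))
  have hs4 : √K * (∫ x, f x ∂P) * (√K * ∫ x, g x ∂P)
      = K * ((∫ x, f x ∂P) * ∫ x, g x ∂P) := by
    rw [mul_mul_mul_comm, Real.mul_self_sqrt hK]
  rw [hs4] at hs3
  nlinarith

/-- The maximum of `(1 + 2x)^5 e^{-3x}` is at `x = 7/6`, with value `(10/3)^5 e^{-7/2} < 14`; the
tangent-line bound for `exp` is taken at that point. -/
lemma one_add_two_mul_pow_five_le {x : ℝ} (hx : 0 ≤ x) :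
    (1 + 2 * x) ^ 5 ≤ 14 * Real.exp (3 * x) := by
  have h1 : 3 / 10 * (1 + 2 * x) ≤ Real.exp (3 / 5 * x - 7 / 10) := by
    have := Real.add_one_le_exp (3 / 5 * x - 7 / 10)
    linarith
  have h2 := pow_le_pow_left₀ (by positivity) h1 5
  rw [← Real.exp_nat_mul, mul_pow] at h2
  have h3 : Real.exp (((5 : ℕ) : ℝ) * (3 / 5 * x - 7 / 10)) * Real.exp (7 / 2)
      = Real.exp (3 * x) := by
    rw [← Real.exp_add]
    congr 1
    push_cast
    ring
  have h4 : (2.7 : ℝ) ^ 7 ≤ Real.exp (7 / 2) ^ 2 := by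
    rw [← Real.exp_nat_mul, show ((2 : ℕ) : ℝ) * (7 / 2) = ((7 : ℕ) : ℝ) * 1 by norm_num,
      Real.exp_nat_mul]
    exact pow_le_pow_left₀ (by norm_num) (by linarith [Real.exp_one_gt_d9]) 7
  have h5 : 32 ≤ Real.exp (7 / 2) := by
    nlinarith [Real.exp_pos (7 / 2)]
  rw [← h3]
  have h6 : (1 + 2 * x) ^ 5 * (3 / 10) ^ 5 * 32
      ≤ Real.exp (((5 : ℕ) : ℝ) * (3 / 5 * x - 7 / 10)) * Real.exp (7 / 2) :=
    mul_le_mul (by linarith) h5 (by norm_num) (Real.exp_pos _).le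
  have h7 : 0 ≤ (1 + 2 * x) ^ 5 := by positivity
  nlinarith

/-- Used with `x = l a/d` and `y = u a/d`. Five of the factors `1 + 2y` cost the constant 14 and one
`e^{3y}`; the other `d - 1` cost `e^{3y}` each. Then `18 · 14 · 27/1024 < 27/4`. -/
lemma pow_ratio_le {d : ℕ} (hd : 1 ≤ d) {x y : ℝ} (hx : 0 < x) (hy : 0 ≤ y) :
    18 * (1 + 2 * y) ^ (d + 4) / (1 + 4 * x) ^ 4 ≤ 27 / 4 * Real.exp (3 * (d * y)) / x := by
  obtain ⟨k, rfl⟩ : ∃ k, d = k + 1 := ⟨d - 1, by omega⟩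
  have h1 := one_add_two_mul_pow_five_le hy
  have h2 : (1 + 2 * y) ^ k ≤ Real.exp (3 * y) ^ k := by
    refine pow_le_pow_left₀ (by positivity) ?_ k
    have := Real.add_one_le_exp (3 * y)
    linarith
  have h3 : (1 + 2 * y) ^ (k + 1 + 4) ≤ 14 * Real.exp (3 * (((k + 1 : ℕ) : ℝ) * y)) := by
    calc (1 + 2 * y) ^ (k + 1 + 4) = (1 + 2 * y) ^ k * (1 + 2 * y) ^ 5 := by ring
      _ ≤ Real.exp (3 * y) ^ k * (14 * Real.exp (3 * y)) :=
        mul_le_mul h2 h1 (by positivity) (by positivity)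
      _ = 14 * Real.exp (3 * (((k + 1 : ℕ) : ℝ) * y)) := by
        rw [← Real.exp_nat_mul, mul_left_comm, ← Real.exp_add]
        push_cast
        ring_nf
  -- The function `x/(1 + 4x)⁴` is maximal at `x = 1/12`, with value `27/1024`.
  have h4 : 1024 * x ≤ 27 * (1 + 4 * x) ^ 4 := by
    nlinarith [mul_nonneg (sq_nonneg (12 * x - 1))
      (by positivity : 0 ≤ 3 * (1 + 4 * x) ^ 2 + 8 * (1 + 4 * x) + 16)]
  rw [div_le_div_iff₀ (by positivity) hx]
  have h6 := Real.exp_pos (3 * (((k + 1 : ℕ) : ℝ) * y))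
  calc 18 * (1 + 2 * y) ^ (k + 1 + 4) * x
      ≤ 18 * (14 * Real.exp (3 * (((k + 1 : ℕ) : ℝ) * y))) * x := by gcongr
    _ ≤ Real.exp (3 * (((k + 1 : ℕ) : ℝ) * y)) * (1 / 4 * (1024 * x)) := by nlinarith
    _ ≤ Real.exp (3 * (((k + 1 : ℕ) : ℝ) * y)) * (1 / 4 * (27 * (1 + 4 * x) ^ 4)) := by gcongr
    _ = _ := by ring

/-- Brings the constant of the mean part under the same bound as the variance part, with room to
spare. -/
lemma sqrt_pow_le {d : ℕ} (hd : 1 ≤ d) {x y : ℝ} (hx : 0 < x) (hxy : x ≤ y) :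
    3 * √(1 + 2 * y) ^ d ≤ 27 / 4 * Real.exp (3 * (d * y)) / x := by
  have hy : 0 ≤ y := hx.le.trans hxy
  have h1 : √(1 + 2 * y) ≤ Real.exp y := by
    refine Real.sqrt_le_iff.2 ⟨(Real.exp_pos _).le, ?_⟩
    rw [← Real.exp_nat_mul]
    have := Real.add_one_le_exp (((2 : ℕ) : ℝ) * y)
    push_cast at this ⊢
    linarith
  have hd1 : (1 : ℝ) ≤ d := by exact_mod_cast hd
  have h2 : √(1 + 2 * y) ^ d ≤ Real.exp (d * y) := by
    rw [Real.exp_nat_mul]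
    exact pow_le_pow_left₀ (Real.sqrt_nonneg _) h1 d
  have h3 : x ≤ Real.exp (d * y) := by
    have := Real.add_one_le_exp (d * y)
    nlinarith
  have h4 : 1 ≤ Real.exp (d * y) := Real.one_le_exp (by positivity)
  have h5 : Real.exp (3 * (d * y)) = Real.exp (d * y) ^ 3 := by
    rw [← Real.exp_nat_mul]
    push_cast
    rfl
  rw [le_div_iff₀ hx, h5]
  calc 3 * √(1 + 2 * y) ^ d * x ≤ 3 * Real.exp (d * y) * Real.exp (d * y) := by gcongr
    _ = 3 * Real.exp (d * y) ^ 2 * 1 := by ring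
    _ ≤ 3 * Real.exp (d * y) ^ 2 * Real.exp (d * y) := by gcongr
    _ ≤ _ := by nlinarith [pow_pos (Real.exp_pos (d * y)) 3]

end SecondMoment

/-! ### Characteristic functions of diagonal Gaussians -/

section CharacteristicFunction

open scoped NNReal ENNReal

variable {d : ℕ}

lemma chrc_eq_charFun (P : ProbabilityMeasure (Vec d)) (ω : Vec d) :
    chrc P ω = charFun (P : Measure (Vec d)) (-ω) := by
  rw [chrc, charFun_apply]
  refine integral_congr_ae (Filter.Eventually.of_forall fun x => ?_)
  simp only [inner_neg_right, real_inner_comm]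
  push_cast
  ring_nf

@[fun_prop]
lemma measurable_chrc (P : ProbabilityMeasure (Vec d)) : Measurable (chrc P) := by
  have : chrc P = fun ω => charFun (P : Measure (Vec d)) (-ω) := funext (chrc_eq_charFun P)
  rw [this]
  exact measurable_charFun.comp measurable_neg

lemma norm_chrc_le_one (P : ProbabilityMeasure (Vec d)) (ω : Vec d) : ‖chrc P ω‖ ≤ 1 := by
  rw [chrc_eq_charFun]
  exact norm_charFun_le_one _

lemma norm_chrc_sub_le_two (P Q : ProbabilityMeasure (Vec d)) (ω : Vec d) :
    ‖chrc P ω - chrc Q ω‖ ≤ 2 := by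
  have := norm_sub_le (chrc P ω) (chrc Q ω)
  linarith [norm_chrc_le_one P ω, norm_chrc_le_one Q ω]

lemma chrc_gaussianDist {θ : Param d} (hθ : ∀ l, 0 ≤ θ.snd l) (ω : Vec d) :
    chrc (gaussianDist θ) ω = (gaussWeight θ.snd ω : ℂ)
      * Complex.exp (((-inner ℝ ω θ.fst : ℝ) : ℂ) * Complex.I) := by
  have hps : (Matrix.diagonal fun l => θ.snd l).PosSemidef := Matrix.PosSemidef.diagonal hθ
  rw [chrc_eq_charFun]
  change charFun (multivariateGaussian θ.fst (Matrix.diagonal fun l => θ.snd l)) (-ω) = _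
  rw [charFun_multivariateGaussian hps, gaussWeight, Complex.ofReal_exp, ← Complex.exp_add]
  congr 1
  rw [inner_neg_left, sub_eq_add_neg, add_comm]
  congr 1
  push_cast
  congr 2
  simp only [Matrix.mulVec_diagonal, dotProduct]
  push_cast
  refine Finset.sum_congr rfl fun i _ => ?_
  simp
  ring

lemma norm_ofReal_mul_exp_sub_sq (p q α β : ℝ) :
    ‖(p : ℂ) * Complex.exp ((α : ℂ) * Complex.I) - (q : ℂ) * Complex.exp ((β : ℂ) * Complex.I)‖ ^ 2
      = (p - q) ^ 2 + 2 * p * q * (1 - Real.cos (β - α)) := by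
  rw [Complex.sq_norm, Complex.normSq_apply]
  simp only [Complex.sub_re, Complex.mul_re, Complex.ofReal_re, Complex.exp_ofReal_mul_I_re,
    Complex.ofReal_im, Complex.exp_ofReal_mul_I_im, zero_mul, sub_zero, Complex.sub_im,
    Complex.mul_im, add_zero]
  rw [Real.cos_sub]
  linear_combination p ^ 2 * Real.sin_sq_add_cos_sq α + q ^ 2 * Real.sin_sq_add_cos_sq β

/-- Polar form: the first term depends on the variances only and the second carries the means. Both
are nonnegative, so their moment comparisons can be done separately and added. -/
lemma norm_chrc_gaussianDist_sub_sq {θ θ' : Param d} (hθ : ∀ l, 0 ≤ θ.snd l)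
    (hθ' : ∀ l, 0 ≤ θ'.snd l) (ω : Vec d) :
    ‖chrc (gaussianDist θ) ω - chrc (gaussianDist θ') ω‖ ^ 2
      = (gaussWeight θ.snd ω - gaussWeight θ'.snd ω) ^ 2
        + 2 * gaussWeight θ.snd ω * gaussWeight θ'.snd ω
          * (1 - Real.cos (∑ i, (θ.fst i - θ'.fst i) * ω i)) := by
  rw [chrc_gaussianDist hθ, chrc_gaussianDist hθ', norm_ofReal_mul_exp_sub_sq]
  congr 4
  simp only [PiLp.inner_apply, RCLike.inner_apply, conj_trivial, sub_mul, Finset.sum_sub_distrib]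
  ring

/-- Both sides have the same characteristic function. The product form is what allows tilting
coordinate by coordinate. -/
lemma freqDist_eq_map_pi {a : ℝ} (ha : 0 ≤ a) :
    freqDist d a = (Measure.pi fun _ : Fin d => gaussianReal 0 (a / d).toNNReal).map
      (WithLp.toLp 2) := by
  have hps : ((a / d) • (1 : Matrix (Fin d) (Fin d) ℝ)).PosSemidef :=
    Matrix.PosSemidef.one.smul (by positivity)
  have had : 0 ≤ a / d := by positivity
  have : IsProbabilityMeasure ((Measure.pi fun _ : Fin d => gaussianReal 0 (a / d).toNNReal).map
      (WithLp.toLp 2 : (Fin d → ℝ) → Vec d)) :=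
    Measure.isProbabilityMeasure_map (by fun_prop)
  rw [freqDist]
  apply Measure.ext_of_charFun (E := EuclideanSpace ℝ (Fin d))
  ext t
  rw [charFun_multivariateGaussian hps]
  simp_rw [charFun_pi, charFun_gaussianReal, ← Complex.exp_sum]
  congr 1
  simp [Matrix.smul_mulVec, dotProduct, Real.coe_toNNReal _ had, Finset.sum_div]
  refine Finset.sum_congr rfl fun i _ => ?_
  ring

instance isProbabilityMeasure_freqDist (a : ℝ) : IsProbabilityMeasure (freqDist d a) := by
  unfold freqDist
  infer_instance

lemma integral_freqDist {a : ℝ} (ha : 0 ≤ a) {f : Vec d → ℝ} (hf : Measurable f) :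
    ∫ ω, f ω ∂freqDist d a
      = ∫ w, f (WithLp.toLp 2 w) ∂(Measure.pi fun _ : Fin d => gaussianReal 0 (a / d).toNNReal) := by
  rw [freqDist_eq_map_pi ha, integral_map (by fun_prop) hf.aestronglyMeasurable]

/-- The second moment of the squared distance of two Gaussian characteristic functions at a random
frequency is controlled by the square of its mean. -/
lemma integral_norm_chrc_sub_pow_four_le (hd : 1 ≤ d) {a : ℝ} (ha : 0 < a) {θ θ' : Param d}
    {l u : ℝ} (hl : 0 < l) (hlu : l ≤ u) (hθ : ∀ i, θ.snd i ∈ Set.Icc l u)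
    (hθ' : ∀ i, θ'.snd i ∈ Set.Icc l u) :
    ∫ ω, (‖chrc (gaussianDist θ) ω - chrc (gaussianDist θ') ω‖ ^ 2) ^ 2 ∂freqDist d a
      ≤ 27 / 8 * (2 * d * Real.exp (3 * a * u) / (a * l))
        * (∫ ω, ‖chrc (gaussianDist θ) ω - chrc (gaussianDist θ') ω‖ ^ 2 ∂freqDist d a) ^ 2 := by
  have hθ0 : ∀ i, 0 ≤ θ.snd i := fun i => hl.le.trans (hθ i).1
  have hθ0' : ∀ i, 0 ≤ θ'.snd i := fun i => hl.le.trans (hθ' i).1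
  have hd0 : (0 : ℝ) < d := by exact_mod_cast hd
  have had : 0 < a / d := by positivity
  have hv : (a / d).toNNReal ≠ 0 := by simpa using had
  have hcoe : ((a / d).toNNReal : ℝ) = a / d := Real.coe_toNNReal _ had.le
  rw [integral_freqDist ha.le (by fun_prop), integral_freqDist ha.le (by fun_prop)]
  simp only [norm_chrc_gaussianDist_sub_sq hθ0 hθ0']
  -- The factor `27/8` is the one for which `9/(32K)` becomes `1/(12 A²)` when `K = (27/8) A²`.
  set K := 27 / 8 * (2 * d * Real.exp (3 * a * u) / (a * l)) with hK
  have hK0 : 0 ≤ K := by positivity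
  have hKeq : K = 27 / 4 * Real.exp (3 * (d * (u * (a / d)))) / (l * (a / d)) := by
    rw [hK, show 3 * (d * (u * (a / d))) = 3 * a * u by field_simp]
    field_simp
    ring
  have hb : ∀ (s : Param d), (∀ i, 0 ≤ s.snd i) → ∀ w : Fin d → ℝ,
      0 < gaussWeight s.snd w ∧ gaussWeight s.snd w ≤ 1 :=
    fun s hs w => ⟨gaussWeight_pos _ _, gaussWeight_le_one hs _⟩
  have hcos : ∀ x : ℝ, 0 ≤ 1 - Real.cos x ∧ 1 - Real.cos x ≤ 2 := fun x =>
    ⟨by linarith [Real.cos_le_one x], by linarith [Real.neg_one_le_cos x]⟩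
  refine integral_add_sq_le (c := 4) (by fun_prop) (by fun_prop) (fun w => sq_nonneg _)
    (fun w => ?_) (fun w => ?_) (fun w => ?_) hK0 ?_ ?_
  · exact mul_nonneg (mul_nonneg (mul_nonneg zero_le_two (hb θ hθ0 w).1.le) (hb θ' hθ0' w).1.le)
      (hcos _).1
  · obtain ⟨h1, h2⟩ := hb θ hθ0 w
    obtain ⟨h3, h4⟩ := hb θ' hθ0' w
    have : |gaussWeight θ.snd w - gaussWeight θ'.snd w| ≤ 1 := by
      rw [abs_le]; constructor <;> linarith
    have := (sq_le_one_iff_abs_le_one _).2 this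
    linarith
  · obtain ⟨h1, h2⟩ := hb θ hθ0 w
    obtain ⟨h3, h4⟩ := hb θ' hθ0' w
    calc _ ≤ 2 * 1 * 1 * (2 : ℝ) := by
          gcongr
          · exact (hcos _).1
          · exact (hcos _).2
      _ = 4 := by norm_num
  · refine (integral_gaussWeight_sub_pow_four_le hv hl.le hθ hθ' hlu).trans ?_
    refine mul_le_mul_of_nonneg_right ?_ (sq_nonneg _)
    rw [hcoe, Fintype.card_fin, hKeq, mul_assoc 2 u, mul_assoc 4 l]
    exact pow_ratio_le hd (by positivity) (mul_nonneg (hl.le.trans hlu) had.le)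
  · refine (integral_sq_gaussWeight_mul_one_sub_cos_le hv hθ0 hθ0' (fun i => (hθ i).2)
      (fun i => (hθ' i).2) _).trans ?_
    refine mul_le_mul_of_nonneg_right ?_ (sq_nonneg _)
    rw [hcoe, Fintype.card_fin, hKeq, mul_assoc 2 u]
    exact sqrt_pow_le hd (by positivity) (mul_le_mul_of_nonneg_right hlu had.le)

lemma mul_exp_neg_le_half (x : ℝ) : x * Real.exp (-x) ≤ 1 / 2 := by
  rcases le_or_gt x 0 with hx | hx
  · exact (mul_nonpos_of_nonpos_of_nonneg hx (Real.exp_pos _).le).trans (by norm_num)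
  · have h := Real.quadratic_le_exp_of_nonneg hx.le
    rw [Real.exp_neg, ← div_eq_mul_inv, div_le_iff₀ (Real.exp_pos _)]
    nlinarith [sq_nonneg (x - 1)]

/-- Characteristic functions of Gaussians are Lipschitz in the parameters, uniformly in the
frequency. -/
lemma norm_chrc_gaussianDist_sub_le {θ θ' : Param d} {l L : ℝ} (hl : 0 < l)
    (hL1 : (√l)⁻¹ ≤ L) (hL2 : l⁻¹ / √2 ≤ L)
    (hθ : ∀ i, l ≤ θ.snd i) (hθ' : ∀ i, l ≤ θ'.snd i) (ω : Vec d) :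
    ‖chrc (gaussianDist θ) ω - chrc (gaussianDist θ') ω‖ ≤ L * ‖θ - θ'‖ := by
  have hθ0 : ∀ i, 0 ≤ θ.snd i := fun i => hl.le.trans (hθ i)
  have hθ0' : ∀ i, 0 ≤ θ'.snd i := fun i => hl.le.trans (hθ' i)
  have hL0 : 0 < L := lt_of_lt_of_le (by positivity) hL1
  have hLl : 1 / l ≤ L ^ 2 := by
    have := pow_le_pow_left₀ (by positivity) hL1 2
    rwa [inv_pow, Real.sq_sqrt hl.le, ← one_div] at this
  have hLl2 : 1 / (2 * l ^ 2) ≤ L ^ 2 := by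
    have := pow_le_pow_left₀ (by positivity) hL2 2
    rw [div_pow, Real.sq_sqrt zero_le_two] at this
    refine le_trans (le_of_eq ?_) this
    field_simp
  set r := ‖ω‖ with hr
  have hr2 : r ^ 2 = ∑ i, ω i ^ 2 := EuclideanSpace.real_norm_sq_eq ω
  set e := Real.exp (-(l * r ^ 2 / 2)) with he
  have hsum : ∀ s : Param d, (∀ i, l ≤ s.snd i) → l * r ^ 2 / 2 ≤ (∑ i, s.snd i * ω i ^ 2) / 2 :=
    fun s hs => by
      rw [hr2, Finset.mul_sum]
      gcongr with i _
      exact hs i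
  have hw : ∀ s : Param d, (∀ i, l ≤ s.snd i) → gaussWeight s.snd ω ≤ e := fun s hs =>
    Real.exp_le_exp.2 (neg_le_neg (hsum s hs))
  set δ := ‖(θ - θ').snd‖ with hδ
  set ν := ‖(θ - θ').fst‖ with hν
  have hquad : |(∑ i, θ.snd i * ω i ^ 2) / 2 - (∑ i, θ'.snd i * ω i ^ 2) / 2| ≤ δ * r ^ 2 / 2 := by
    rw [← sub_div, ← Finset.sum_sub_distrib, abs_div, abs_two]
    refine div_le_div_of_nonneg_right ?_ zero_le_two
    refine (Finset.abs_sum_le_sum_abs _ _).trans ?_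
    rw [hr2, Finset.mul_sum]
    refine Finset.sum_le_sum fun i _ => ?_
    rw [← sub_mul, abs_mul, abs_of_nonneg (sq_nonneg (ω i))]
    refine mul_le_mul_of_nonneg_right ?_ (sq_nonneg _)
    simpa [hδ] using PiLp.norm_apply_le (θ - θ').snd i
  have h1 : |gaussWeight θ.snd ω - gaussWeight θ'.snd ω| ≤ r ^ 2 / 2 * e * δ := by
    refine (abs_exp_neg_sub_le (hsum θ hθ) (hsum θ' hθ')).trans ?_
    refine (mul_le_mul_of_nonneg_right hquad (Real.exp_pos _).le).trans (le_of_eq ?_)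
    ring
  have h2 : ‖Complex.exp (((-inner ℝ ω θ.fst : ℝ) : ℂ) * Complex.I)
      - Complex.exp (((-inner ℝ ω θ'.fst : ℝ) : ℂ) * Complex.I)‖ ≤ r * ν := by
    have h3 : ‖Complex.exp (((-inner ℝ ω θ.fst : ℝ) : ℂ) * Complex.I)
        - Complex.exp (((-inner ℝ ω θ'.fst : ℝ) : ℂ) * Complex.I)‖
        ≤ |(-inner ℝ ω θ.fst) - (-inner ℝ ω θ'.fst)| := by
      have h4 := norm_ofReal_mul_exp_sub_sq 1 1 (-inner ℝ ω θ.fst) (-inner ℝ ω θ'.fst)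
      simp only [Complex.ofReal_one, one_mul, sub_self] at h4
      refine abs_le_of_sq_le_sq' ?_ (abs_nonneg _) |>.2
      rw [h4, sq_abs]
      have := Real.one_sub_sq_div_two_le_cos (x := (-inner ℝ ω θ'.fst) - (-inner ℝ ω θ.fst))
      nlinarith
    refine h3.trans ?_
    rw [show (-inner ℝ ω θ.fst) - (-inner ℝ ω θ'.fst) = -(inner ℝ ω (θ - θ').fst) by
      simp [inner_sub_right]; ring, abs_neg]
    exact abs_real_inner_le_norm _ _
  have hmain : ‖chrc (gaussianDist θ) ω - chrc (gaussianDist θ') ω‖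
      ≤ r ^ 2 / 2 * e * δ + r * e * ν := by
    rw [chrc_gaussianDist hθ0, chrc_gaussianDist hθ0']
    set E1 := Complex.exp (((-inner ℝ ω θ.fst : ℝ) : ℂ) * Complex.I)
    set E2 := Complex.exp (((-inner ℝ ω θ'.fst : ℝ) : ℂ) * Complex.I)
    have hE1 : ‖E1‖ = 1 := Complex.norm_exp_ofReal_mul_I _
    have : (gaussWeight θ.snd ω : ℂ) * E1 - (gaussWeight θ'.snd ω : ℂ) * E2
        = ((gaussWeight θ.snd ω - gaussWeight θ'.snd ω : ℝ) : ℂ) * E1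
          + (gaussWeight θ'.snd ω : ℂ) * (E1 - E2) := by
      push_cast; ring
    rw [this]
    refine (norm_add_le _ _).trans (add_le_add ?_ ?_)
    · rw [norm_mul, hE1, mul_one, Complex.norm_real]
      exact h1
    · rw [norm_mul, Complex.norm_real, Real.norm_of_nonneg (gaussWeight_pos _ _).le]
      calc _ ≤ e * (r * ν) := mul_le_mul (hw θ' hθ') h2 (norm_nonneg _) (Real.exp_pos _).le
        _ = _ := by ring
  have hnorm : ‖θ - θ'‖ ^ 2 = ν ^ 2 + δ ^ 2 := WithLp.prod_norm_sq_eq_of_L2 _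
  -- Each summand is at most `L²/2`, since `x e^{-x} ≤ 1/2`: the variance slope squared is at most
  -- `1/(4 l²)` and the mean slope squared at most `1/(2l)`. This explains the two entries of the
  -- maximum in `constL`.
  have hκ : (r ^ 2 / 2 * e) ^ 2 + (r * e) ^ 2 ≤ L ^ 2 := by
    have h3 : r ^ 2 / 2 * e ≤ 1 / (2 * l) := by
      have := mul_exp_neg_le_half (l * r ^ 2 / 2)
      rw [le_div_iff₀ (by positivity)]
      nlinarith
    have h4 : (r * e) ^ 2 ≤ 1 / (2 * l) := by
      have := mul_exp_neg_le_half (l * r ^ 2)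
      have he2 : e ^ 2 = Real.exp (-(l * r ^ 2)) := by
        rw [he, ← Real.exp_nat_mul]
        congr 1
        push_cast
        ring
      rw [mul_pow, he2, le_div_iff₀ (by positivity)]
      nlinarith
    have h5 := pow_le_pow_left₀ (by positivity) h3 2
    have h6 : (1 / (2 * l)) ^ 2 = 1 / 2 * (1 / (2 * l ^ 2)) := by field_simp
    have h7 : 1 / (2 * l) = 1 / 2 * (1 / l) := by field_simp
    linarith
  refine hmain.trans (abs_le_of_sq_le_sq' ?_ (by positivity)).2
  rw [mul_pow, hnorm]
  have h8 : (r ^ 2 / 2 * e * δ + r * e * ν) ^ 2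
      ≤ ((r ^ 2 / 2 * e) ^ 2 + (r * e) ^ 2) * (ν ^ 2 + δ ^ 2) := by
    nlinarith [sq_nonneg (r ^ 2 / 2 * e * ν - r * e * δ)]
  exact h8.trans (mul_le_mul_of_nonneg_right hκ (by positivity))

end CharacteristicFunction

/-! ### Covering numbers in finite dimension -/

section Covering

/-- Volume comparison: the balls of radius `ε/2` are disjoint and contained in a ball of radius `r +
ε/2`. -/
lemma card_mul_pow_le_of_separated {E : Type*} [NormedAddCommGroup E] [NormedSpace ℝ E]
    [FiniteDimensional ℝ E] {s : Finset E} {c : E} {r ε : ℝ} (hr : 0 ≤ r) (hε : 0 < ε)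
    (hs : ∀ x ∈ s, x ∈ Metric.closedBall c r) (hsep : ∀ x ∈ s, ∀ y ∈ s, x ≠ y → ε ≤ dist x y) :
    (s.card : ℝ) ≤ (1 + 2 * r / ε) ^ Module.finrank ℝ E := by
  borelize E
  let μ : Measure E := Measure.addHaar
  have hdisj : (s : Set E).PairwiseDisjoint fun x => Metric.ball x (ε / 2) := fun x hx y hy hxy =>
    Metric.ball_disjoint_ball (by linarith [hsep x hx y hy hxy])
  have hsub : (⋃ x ∈ s, Metric.ball x (ε / 2)) ⊆ Metric.ball c (r + ε / 2) := by
    refine Set.iUnion₂_subset fun x hx => Metric.ball_subset_ball' ?_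
    have := Metric.mem_closedBall.1 (hs x hx)
    linarith
  have h1 := measure_mono (μ := μ) hsub
  rw [measure_biUnion_finset hdisj fun _ _ => Metric.isOpen_ball.measurableSet] at h1
  simp only [Measure.addHaar_ball_of_pos μ _ (half_pos hε),
    Measure.addHaar_ball_of_pos μ _ (by positivity : 0 < r + ε / 2), Finset.sum_const,
    nsmul_eq_mul, ← mul_assoc] at h1
  rw [ENNReal.mul_le_mul_iff_left (Metric.measure_ball_pos μ 0 one_pos).ne'
    measure_ball_lt_top.ne, ← ENNReal.ofReal_natCast, ← ENNReal.ofReal_mul (by positivity),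
    ENNReal.ofReal_le_ofReal_iff (by positivity)] at h1
  have h2 : 1 + 2 * r / ε = (r + ε / 2) / (ε / 2) := by field_simp; ring
  rw [h2, div_pow, le_div_iff₀ (by positivity)]
  exact h1

/-- A separated set that is not a net can be enlarged; without a small net this would never stop,
against the volume bound. The centres lie in `T`, where the Gaussian estimates are available. -/
lemma exists_finset_cover {E : Type*} [NormedAddCommGroup E] [NormedSpace ℝ E]
    [FiniteDimensional ℝ E] {T : Set E} {c : E} {r ε : ℝ} (hr : 0 ≤ r) (hε : 0 < ε)
    (hT : T ⊆ Metric.closedBall c r) :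
    ∃ s : Finset E, ↑s ⊆ T ∧ (∀ x ∈ T, ∃ y ∈ s, dist x y ≤ ε) ∧
      (s.card : ℝ) ≤ (1 + 2 * r / ε) ^ Module.finrank ℝ E := by
  classical
  by_contra! hcon
  have hbig : ∀ k : ℕ, ∃ s : Finset E, s.card = k ∧ ↑s ⊆ T ∧
      ∀ x ∈ s, ∀ y ∈ s, x ≠ y → ε ≤ dist x y := by
    intro k
    induction k with
    | zero => exact ⟨∅, by simp⟩
    | succ k ih =>
      obtain ⟨s, hk, hsT, hsep⟩ := ih
      have hcard := card_mul_pow_le_of_separated hr hε (fun x hx => hT (hsT hx)) hsep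
      obtain ⟨x, hxT, hx⟩ : ∃ x ∈ T, ∀ y ∈ s, ε < dist x y := by
        by_contra! h
        exact absurd (hcon s hsT h) (not_lt.2 hcard)
      have hxs : x ∉ s := fun h => by
        have := hx x h
        rw [dist_self] at this
        linarith
      refine ⟨insert x s, by rw [Finset.card_insert_of_notMem hxs, hk], ?_, ?_⟩
      · rw [Finset.coe_insert]
        exact Set.insert_subset hxT hsT
      · intro y hy z hz hyz
        rcases Finset.mem_insert.1 hy with hyx | hys
        · rcases Finset.mem_insert.1 hz with hzx | hzs
          · exact absurd (hyx.trans hzx.symm) hyz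
          · rw [hyx]; exact (hx z hzs).le
        · rcases Finset.mem_insert.1 hz with hzx | hzs
          · rw [hzx, dist_comm]; exact (hx y hys).le
          · exact hsep y hys z hzs hyz
  obtain ⟨k, hk⟩ := exists_nat_gt ((1 + 2 * r / ε) ^ Module.finrank ℝ E)
  obtain ⟨s, hsk, hsT, hsep⟩ := hbig k
  have := card_mul_pow_le_of_separated hr hε (fun x hx => hT (hsT hx)) hsep
  rw [hsk] at this
  linarith

end Covering

/-! ### Total variation and the maximum mean discrepancy -/

section Distances

variable {d : ℕ}

lemma measurable_expChar (ω : Vec d) :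
    Measurable fun x : Vec d => Complex.exp (-(Complex.I * ((inner ℝ ω x : ℝ) : ℂ))) := by
  fun_prop

lemma norm_expChar (t : ℝ) : ‖Complex.exp (-(Complex.I * (t : ℂ)))‖ = 1 := by
  rw [← mul_neg, mul_comm, ← Complex.ofReal_neg, Complex.norm_exp_ofReal_mul_I]

lemma integrable_expChar (μ : Measure (Vec d)) [IsFiniteMeasure μ] (ω : Vec d) :
    Integrable (fun x : Vec d => Complex.exp (-(Complex.I * ((inner ℝ ω x : ℝ) : ℂ)))) μ :=
  Integrable.of_bound (measurable_expChar ω).aestronglyMeasurable 1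
    (Filter.Eventually.of_forall fun _ => (norm_expChar _).le)

/-- The difference is the integral of a unimodular function against `P - Q`; the Jordan
decomposition bounds it by the total masses of the two parts. -/
lemma norm_chrc_sub_le_tvDist (P Q : ProbabilityMeasure (Vec d)) (ω : Vec d) :
    ‖chrc P ω - chrc Q ω‖ ≤ tvDist P Q := by
  set σ := (P : Measure (Vec d)).toSignedMeasure - (Q : Measure (Vec d)).toSignedMeasure with hσ
  set j := σ.toJordanDecomposition with hj
  have h1 : j.posPart.toSignedMeasure - j.negPart.toSignedMeasure = σ :=
    SignedMeasure.toSignedMeasure_toJordanDecomposition σ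
  have h2 : (P : Measure (Vec d)) + j.negPart = (Q : Measure (Vec d)) + j.posPart := by
    rw [← Measure.toSignedMeasure_eq_toSignedMeasure_iff, Measure.toSignedMeasure_add,
      Measure.toSignedMeasure_add, add_comm (Measure.toSignedMeasure (Q : Measure (Vec d)))]
    rw [hσ, sub_eq_sub_iff_add_eq_add] at h1
    exact h1.symm
  have hi := fun (μ : Measure (Vec d)) [IsFiniteMeasure μ] => integrable_expChar μ ω
  have h3 := congrArg (fun μ : Measure (Vec d) =>
    ∫ x, Complex.exp (-(Complex.I * ((inner ℝ ω x : ℝ) : ℂ))) ∂μ) h2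
  rw [integral_add_measure (hi _) (hi _), integral_add_measure (hi _) (hi _)] at h3
  have h4 : chrc P ω - chrc Q ω
      = (∫ x, Complex.exp (-(Complex.I * ((inner ℝ ω x : ℝ) : ℂ))) ∂j.posPart)
        - ∫ x, Complex.exp (-(Complex.I * ((inner ℝ ω x : ℝ) : ℂ))) ∂j.negPart := by
    rw [chrc, chrc]
    linear_combination h3
  have hb : ∀ (μ : Measure (Vec d)) [IsFiniteMeasure μ],
      ‖∫ x, Complex.exp (-(Complex.I * ((inner ℝ ω x : ℝ) : ℂ))) ∂μ‖ ≤ μ.real Set.univ :=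
    fun μ _ => by
      have := norm_integral_le_of_norm_le_const (μ := μ) (C := 1)
        (f := fun x => Complex.exp (-(Complex.I * ((inner ℝ ω x : ℝ) : ℂ))))
        (Filter.Eventually.of_forall fun _ => (norm_expChar _).le)
      simpa using this
  have h5 : tvDist P Q = j.posPart.real Set.univ + j.negPart.real Set.univ := by
    change (σ.totalVariation Set.univ).toReal = _
    rw [SignedMeasure.totalVariation, Measure.add_apply,
      ENNReal.toReal_add (measure_ne_top _ _) (measure_ne_top _ _)]
    rfl
  rw [h4, h5]
  exact (norm_sub_le _ _).trans (add_le_add (hb _) (hb _))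

lemma mmd_nonneg (Λ : Measure (Vec d)) (P Q : ProbabilityMeasure (Vec d)) : 0 ≤ mmd Λ P Q :=
  Real.sqrt_nonneg _

lemma sq_mmd (Λ : Measure (Vec d)) (P Q : ProbabilityMeasure (Vec d)) :
    mmd Λ P Q ^ 2 = ∫ ω, ‖chrc P ω - chrc Q ω‖ ^ 2 ∂Λ :=
  Real.sq_sqrt (integral_nonneg fun _ => sq_nonneg _)

lemma mmd_le_of_forall_norm_le (Λ : Measure (Vec d)) [IsProbabilityMeasure Λ]
    {P Q : ProbabilityMeasure (Vec d)} {c : ℝ} (hc : ∀ ω, ‖chrc P ω - chrc Q ω‖ ≤ c) :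
    mmd Λ P Q ≤ c := by
  have hc0 : 0 ≤ c := (norm_nonneg _).trans (hc 0)
  refine Real.sqrt_le_iff.2 ⟨hc0, ?_⟩
  have h := integral_mono (μ := Λ) (f := fun ω => ‖chrc P ω - chrc Q ω‖ ^ 2) (g := fun _ => c ^ 2)
    (integrable_of_nonneg_of_le (by fun_prop) (fun _ => sq_nonneg _)
      fun ω => pow_le_pow_left₀ (norm_nonneg _) (hc ω) 2) (integrable_const _)
    fun ω => pow_le_pow_left₀ (norm_nonneg _) (hc ω) 2
  simpa using h

/-- Minkowski's inequality in `L²(Λ)`. The pointwise bounds serve integrability only. -/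
lemma mmd_triangle (Λ : Measure (Vec d)) [IsFiniteMeasure Λ] (P Q R : ProbabilityMeasure (Vec d)) :
    mmd Λ P R ≤ mmd Λ P Q + mmd Λ Q R := by
  set f : Vec d → ℝ := fun ω => ‖chrc P ω - chrc Q ω‖ with hf
  set g : Vec d → ℝ := fun ω => ‖chrc Q ω - chrc R ω‖ with hg
  have hfm : Measurable f := by fun_prop
  have hgm : Measurable g := by fun_prop
  refine Real.sqrt_le_iff.2 ⟨add_nonneg (mmd_nonneg _ _ _) (mmd_nonneg _ _ _), ?_⟩
  have hle : ∀ ω, ‖chrc P ω - chrc R ω‖ ^ 2 ≤ (f ω + g ω) ^ 2 := fun ω =>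
    pow_le_pow_left₀ (norm_nonneg _) (norm_sub_le_norm_sub_add_norm_sub _ _ _) 2
  have h4 : ∀ ω, f ω + g ω ≤ 4 := fun ω => by
    have h1 := norm_chrc_sub_le_two P Q ω
    have h2 := norm_chrc_sub_le_two Q R ω
    simp only [hf, hg]
    linarith
  have hfg0 : ∀ ω, 0 ≤ f ω + g ω := fun ω => add_nonneg (norm_nonneg _) (norm_nonneg _)
  have hcs := integral_mul_le_sqrt_mul_sqrt (P := Λ) hfm hgm (fun _ => norm_nonneg _)
    (fun _ => norm_nonneg _) (norm_chrc_sub_le_two P Q) (norm_chrc_sub_le_two Q R)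
  calc ∫ ω, ‖chrc P ω - chrc R ω‖ ^ 2 ∂Λ ≤ ∫ ω, (f ω + g ω) ^ 2 ∂Λ := by
        refine integral_mono ?_ ?_ hle
        · exact integrable_of_nonneg_of_le (by fun_prop) (fun _ => sq_nonneg _) fun ω =>
            (hle ω).trans (pow_le_pow_left₀ (hfg0 ω) (h4 ω) 2)
        · exact integrable_of_nonneg_of_le (by fun_prop) (fun _ => sq_nonneg _) fun ω =>
            pow_le_pow_left₀ (hfg0 ω) (h4 ω) 2
    _ = mmd Λ P Q ^ 2 + 2 * ∫ ω, f ω * g ω ∂Λ + mmd Λ Q R ^ 2 := by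
        rw [integral_add_sq hfm hgm (fun _ => norm_nonneg _) (fun _ => norm_nonneg _)
          (norm_chrc_sub_le_two P Q) (norm_chrc_sub_le_two Q R), sq_mmd, sq_mmd]
    _ ≤ mmd Λ P Q ^ 2 + 2 * (mmd Λ P Q * mmd Λ Q R) + mmd Λ Q R ^ 2 := by
        gcongr
        exact hcs
    _ = _ := by ring

end Distances

/-! ### The sketch and the concentration of the empirical sketch -/

section Sketch

variable {d m n : ℕ}

lemma sq_norm_toLp_scaled (g : Fin m → ℂ) :
    ‖(WithLp.toLp 2 fun j => ((1 / √(m : ℝ) : ℝ) : ℂ) * g j : EuclideanSpace ℂ (Fin m))‖ ^ 2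
      = 1 / m * ∑ j, ‖g j‖ ^ 2 := by
  rw [EuclideanSpace.norm_sq_eq, Finset.mul_sum]
  refine Finset.sum_congr rfl fun j _ => ?_
  simp only [norm_mul, Complex.norm_real, mul_pow]
  congr 1
  rw [Real.norm_of_nonneg (by positivity), div_pow, Real.sq_sqrt (Nat.cast_nonneg _), one_pow]

lemma norm_toLp_scaled_le {g : Fin m → ℂ} {c : ℝ} (hc0 : 0 ≤ c) (hc : ∀ j, ‖g j‖ ≤ c) :
    ‖(WithLp.toLp 2 fun j => ((1 / √(m : ℝ) : ℝ) : ℂ) * g j : EuclideanSpace ℂ (Fin m))‖ ≤ c := by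
  refine (abs_le_of_sq_le_sq' ?_ hc0).2
  rw [sq_norm_toLp_scaled]
  have h1 : ∑ j, ‖g j‖ ^ 2 ≤ m * c ^ 2 := by
    have := Finset.sum_le_sum fun (j : Fin m) (_ : j ∈ Finset.univ) =>
      pow_le_pow_left₀ (norm_nonneg _) (hc j) 2
    simpa using this
  -- For `m = 0` the vector is empty and its norm is zero.
  rcases Nat.eq_zero_or_pos m with hm | hm
  · subst hm
    simp
    positivity
  · have hm0 : (0 : ℝ) < m := by exact_mod_cast hm
    calc 1 / m * ∑ j, ‖g j‖ ^ 2 ≤ 1 / m * (m * c ^ 2) := by gcongr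
      _ = c ^ 2 := by field_simp

lemma sketch_sub_sketch (ω : Fin m → Vec d) (P Q : ProbabilityMeasure (Vec d)) :
    sketch ω P - sketch ω Q
      = WithLp.toLp 2 fun j => ((1 / √(m : ℝ) : ℝ) : ℂ) * (chrc P (ω j) - chrc Q (ω j)) := by
  ext j
  simp [sketch, mul_sub]

lemma norm_sketch_sub_le {P Q : ProbabilityMeasure (Vec d)} {c : ℝ}
    (hc : ∀ ω, ‖chrc P ω - chrc Q ω‖ ≤ c) (ω : Fin m → Vec d) :
    ‖sketch ω P - sketch ω Q‖ ≤ c := by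
  rw [sketch_sub_sketch]
  exact norm_toLp_scaled_le ((norm_nonneg _).trans (hc 0)) fun j => hc _

lemma sq_norm_sketch_sub (ω : Fin m → Vec d) (P Q : ProbabilityMeasure (Vec d)) :
    ‖sketch ω P - sketch ω Q‖ ^ 2 = 1 / m * ∑ j, ‖chrc P (ω j) - chrc Q (ω j)‖ ^ 2 := by
  rw [sketch_sub_sketch, sq_norm_toLp_scaled]

lemma empiricalSketch_sub_sketch (ω : Fin m → Vec d) (x : Fin n → Vec d)
    (P : ProbabilityMeasure (Vec d)) :
    empiricalSketch ω x - sketch ω P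
      = WithLp.toLp 2 fun j => ((1 / √(m : ℝ) : ℝ) : ℂ) *
        ((1 / (n : ℂ)) * (∑ i, Complex.exp (-(Complex.I * ((inner ℝ (ω j) (x i) : ℝ) : ℂ))))
          - chrc P (ω j)) := by
  ext j
  simp [sketch, empiricalSketch, mul_sub]

lemma measurable_norm_empiricalSketch_sub_sketch (P : ProbabilityMeasure (Vec d)) :
    Measurable fun p : (Fin n → Vec d) × (Fin m → Vec d) =>
      ‖empiricalSketch p.2 p.1 - sketch p.2 P‖ := by
  simp only [empiricalSketch_sub_sketch]
  refine Measurable.norm ?_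
  refine (WithLp.measurable_toLp 2 _).comp (measurable_pi_lambda _ fun j => ?_)
  have h1 : Measurable fun p : (Fin n → Vec d) × (Fin m → Vec d) => p.2 j :=
    (measurable_pi_apply j).comp measurable_snd
  have h2 : ∀ i, Measurable fun p : (Fin n → Vec d) × (Fin m → Vec d) => p.1 i := fun i =>
    (measurable_pi_apply i).comp measurable_fst
  have h3 : Measurable fun p : (Fin n → Vec d) × (Fin m → Vec d) => chrc P (p.2 j) :=
    (measurable_chrc P).comp h1
  fun_prop

/-- The left side is the variance of an average of independent copies, and a variance is at most the
second moment. -/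
lemma integral_empirical_mean_sub_sq_le {E : Type*} [MeasurableSpace E] {μ : Measure E}
    [IsProbabilityMeasure μ] {f : E → ℝ} (hf : MemLp f 2 μ) (hn : 1 ≤ n) :
    ∫ x, ((1 / n) * (∑ i, f (x i)) - ∫ y, f y ∂μ) ^ 2 ∂(Measure.pi fun _ : Fin n => μ)
      ≤ 1 / n * ∫ y, f y ^ 2 ∂μ := by
  have hn0 : (0 : ℝ) < n := by exact_mod_cast hn
  set ν := Measure.pi fun _ : Fin n => μ with hν
  have hi : Integrable f μ := hf.integrable one_le_two
  have hei : ∀ i : Fin n, Integrable (fun x : Fin n → E => f (x i)) ν := fun i =>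
    integrable_comp_eval (μ := fun _ : Fin n => μ) (i := i) hi
  set S : (Fin n → E) → ℝ := fun x => (1 / n) * ∑ i, f (x i) with hS
  have hmean : ∫ x, S x ∂ν = ∫ y, f y ∂μ := by
    rw [hS, integral_const_mul, integral_finsetSum _ fun i _ => hei i]
    have : ∀ i : Fin n, ∫ x, f (x i) ∂ν = ∫ y, f y ∂μ := fun i =>
      integral_comp_eval (μ := fun _ : Fin n => μ) (i := i) hi.aestronglyMeasurable
    simp only [this, Finset.sum_const, Finset.card_univ, Fintype.card_fin, nsmul_eq_mul]
    field_simp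
  have hSm : AEMeasurable S ν := by
    refine AEMeasurable.const_mul ?_ _
    exact Finset.aemeasurable_fun_sum _ fun i _ => (hei i).aestronglyMeasurable.aemeasurable
  have hvar : Var[S; ν] = 1 / n * Var[f; μ] := by
    rw [hS, variance_const_mul]
    have := variance_sum_pi (μ := fun _ : Fin n => μ) (X := fun _ => f) fun _ => hf
    have hfun : (∑ i, fun ω : Fin n → E => f (ω i)) = fun x => ∑ i, f (x i) := by
      ext x; simp
    rw [hfun] at this
    rw [this]
    simp only [Finset.sum_const, Finset.card_univ, Fintype.card_fin, nsmul_eq_mul]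
    field_simp
  rw [variance_eq_integral hSm, hmean] at hvar
  rw [hvar]
  gcongr
  exact variance_le_expectation_sq hf.aestronglyMeasurable

/-- The empirical characteristic function is close to the true one in mean square. -/
lemma integral_sq_norm_empirical_sub_chrc_le (P : ProbabilityMeasure (Vec d)) (hn : 1 ≤ n)
    (ω : Vec d) :
    ∫ x, ‖(1 / (n : ℂ)) * (∑ i, Complex.exp (-(Complex.I * ((inner ℝ ω (x i) : ℝ) : ℂ))))
        - chrc P ω‖ ^ 2 ∂(Measure.pi fun _ : Fin n => (P : Measure (Vec d))) ≤ 1 / n := by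
  set φ : Vec d → ℂ := fun x => Complex.exp (-(Complex.I * ((inner ℝ ω x : ℝ) : ℂ))) with hφ
  have hφm : Measurable φ := measurable_expChar ω
  have hφ1 : ∀ x, ‖φ x‖ = 1 := fun x => norm_expChar _
  have hφi : Integrable φ (P : Measure (Vec d)) := integrable_expChar _ ω
  have hre : MemLp (fun x => (φ x).re) 2 (P : Measure (Vec d)) :=
    MemLp.of_bound (by fun_prop) 1 (Filter.Eventually.of_forall fun x => by
      rw [← hφ1 x]; exact Complex.abs_re_le_norm _)
  have him : MemLp (fun x => (φ x).im) 2 (P : Measure (Vec d)) :=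
    MemLp.of_bound (by fun_prop) 1 (Filter.Eventually.of_forall fun x => by
      rw [← hφ1 x]; exact Complex.abs_im_le_norm _)
  have h1 := integral_empirical_mean_sub_sq_le hre hn
  have h2 := integral_empirical_mean_sub_sq_le him hn
  have hcre : (chrc P ω).re = ∫ x, (φ x).re ∂(P : Measure (Vec d)) := (integral_re hφi).symm
  have hcim : (chrc P ω).im = ∫ x, (φ x).im ∂(P : Measure (Vec d)) := (integral_im hφi).symm
  have hcast : (1 / (n : ℂ)) = ((1 / (n : ℝ) : ℝ) : ℂ) := by push_cast; rfl
  have heq : ∀ x : Fin n → Vec d, ‖(1 / (n : ℂ)) * (∑ i, φ (x i)) - chrc P ω‖ ^ 2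
      = ((1 / n) * (∑ i, (φ (x i)).re) - ∫ y, (φ y).re ∂(P : Measure (Vec d))) ^ 2
        + ((1 / n) * (∑ i, (φ (x i)).im) - ∫ y, (φ y).im ∂(P : Measure (Vec d))) ^ 2 := fun x => by
    rw [Complex.sq_norm, Complex.normSq_apply, hcast, Complex.sub_re, Complex.sub_im,
      Complex.re_ofReal_mul, Complex.im_ofReal_mul, Complex.re_sum, Complex.im_sum, hcre, hcim]
    ring
  change ∫ x : Fin n → Vec d, ‖(1 / (n : ℂ)) * (∑ i, φ (x i)) - chrc P ω‖ ^ 2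
    ∂(Measure.pi fun _ : Fin n => (P : Measure (Vec d))) ≤ 1 / n
  simp only [heq]
  have hbd : ∀ g : Vec d → ℝ, Measurable g → (∀ x, |g x| ≤ 1) →
      Integrable (fun x : Fin n → Vec d => ((1 / n) * (∑ i, g (x i))
        - ∫ y, g y ∂(P : Measure (Vec d))) ^ 2)
        (Measure.pi fun _ : Fin n => (P : Measure (Vec d))) := fun g hg hgb => by
    have hE : |∫ y, g y ∂(P : Measure (Vec d))| ≤ 1 := by
      have := norm_integral_le_of_norm_le_const (μ := (P : Measure (Vec d))) (C := 1) (f := g)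
        (Filter.Eventually.of_forall hgb)
      simpa using this
    refine Integrable.of_bound (Measurable.aestronglyMeasurable (by fun_prop)) (2 ^ 2)
      (Filter.Eventually.of_forall fun x => ?_)
    rw [norm_pow]
    refine pow_le_pow_left₀ (norm_nonneg _) ((norm_sub_le _ _).trans ?_) 2
    have hs : ‖∑ i, g (x i)‖ ≤ n := by
      refine (norm_sum_le _ _).trans ?_
      refine (Finset.sum_le_sum fun i _ => hgb (x i)).trans ?_
      simp
    have hn0 : (0 : ℝ) < n := by exact_mod_cast hn
    have : ‖1 / (n : ℝ) * ∑ i, g (x i)‖ ≤ 1 := by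
      rw [norm_mul, Real.norm_of_nonneg (by positivity)]
      calc _ ≤ 1 / (n : ℝ) * n := by gcongr
        _ = 1 := by field_simp
    rw [Real.norm_eq_abs (∫ y, g y ∂(P : Measure (Vec d)))]
    linarith
  rw [integral_add (hbd _ (by fun_prop) fun x => (Complex.abs_re_le_norm _).trans (hφ1 x).le)
    (hbd _ (by fun_prop) fun x => (Complex.abs_im_le_norm _).trans (hφ1 x).le)]
  refine (add_le_add h1 h2).trans (le_of_eq ?_)
  rw [← mul_add, ← integral_add hre.integrable_sq him.integrable_sq]
  -- As `φ` has modulus one, the second moments of its real and imaginary parts add up to one.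
  have : ∀ x, (φ x).re ^ 2 + (φ x).im ^ 2 = 1 := fun x => by
    have h := Complex.sq_norm (φ x)
    rw [hφ1, Complex.normSq_apply] at h
    linarith
  simp [this]

lemma norm_empirical_le_one (hn : 1 ≤ n) (ω : Vec d) (x : Fin n → Vec d) :
    ‖(1 / (n : ℂ)) * ∑ i, Complex.exp (-(Complex.I * ((inner ℝ ω (x i) : ℝ) : ℂ)))‖ ≤ 1 := by
  have hn0 : (0 : ℝ) < n := by exact_mod_cast hn
  rw [norm_mul, norm_div, norm_one, Complex.norm_natCast]
  have : ‖∑ i, Complex.exp (-(Complex.I * ((inner ℝ ω (x i) : ℝ) : ℂ)))‖ ≤ n := by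
    refine (norm_sum_le _ _).trans ?_
    simp [norm_expChar]
  calc _ ≤ 1 / (n : ℝ) * n := by gcongr
    _ = 1 := by field_simp

lemma norm_empirical_sub_chrc_le_two (P : ProbabilityMeasure (Vec d)) (hn : 1 ≤ n) (ω : Vec d)
    (x : Fin n → Vec d) :
    ‖(1 / (n : ℂ)) * (∑ i, Complex.exp (-(Complex.I * ((inner ℝ ω (x i) : ℝ) : ℂ))))
      - chrc P ω‖ ≤ 2 :=
  (norm_sub_le _ _).trans (by linarith [norm_empirical_le_one hn ω x, norm_chrc_le_one P ω])

lemma norm_empiricalSketch_sub_sketch_le_two (P : ProbabilityMeasure (Vec d)) (hn : 1 ≤ n)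
    (ω : Fin m → Vec d) (x : Fin n → Vec d) : ‖empiricalSketch ω x - sketch ω P‖ ≤ 2 := by
  rw [empiricalSketch_sub_sketch]
  exact norm_toLp_scaled_le zero_le_two fun j => norm_empirical_sub_chrc_le_two P hn (ω j) x

/-- The bounded difference needed for McDiarmid, uniform in the frequencies: only one exponential
changes, by at most two. -/
lemma norm_empiricalSketch_sub_update_le (hn : 1 ≤ n) (ω : Fin m → Vec d) (x : Fin n → Vec d)
    (i : Fin n) (y : Vec d) :
    ‖empiricalSketch ω x - empiricalSketch ω (Function.update x i y)‖ ≤ 2 / n := by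
  have hn0 : (0 : ℝ) < n := by exact_mod_cast hn
  have heq : empiricalSketch ω x - empiricalSketch ω (Function.update x i y)
      = WithLp.toLp 2 fun j => ((1 / √(m : ℝ) : ℝ) : ℂ) * ((1 / (n : ℂ)) *
        (Complex.exp (-(Complex.I * ((inner ℝ (ω j) (x i) : ℝ) : ℂ)))
          - Complex.exp (-(Complex.I * ((inner ℝ (ω j) y : ℝ) : ℂ))))) := by
    ext j
    simp only [empiricalSketch, PiLp.sub_apply]
    rw [← mul_sub, ← mul_sub, ← Finset.sum_sub_distrib, Finset.sum_eq_single i]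
    · rw [Function.update_self]
    · intro k _ hk
      rw [Function.update_of_ne hk, sub_self]
    · simp
  rw [heq]
  refine norm_toLp_scaled_le (by positivity) fun j => ?_
  rw [norm_mul, norm_div, norm_one, Complex.norm_natCast, div_mul_eq_mul_div, one_mul]
  refine div_le_div_of_nonneg_right ((norm_sub_le _ _).trans ?_) hn0.le
  rw [norm_expChar, norm_expChar]
  norm_num

lemma integral_sq_norm_empiricalSketch_sub_le (P : ProbabilityMeasure (Vec d)) (hn : 1 ≤ n)
    (ω : Fin m → Vec d) :
    ∫ x, ‖empiricalSketch ω x - sketch ω P‖ ^ 2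
      ∂(Measure.pi fun _ : Fin n => (P : Measure (Vec d))) ≤ (n : ℝ)⁻¹ := by
  simp only [empiricalSketch_sub_sketch, sq_norm_toLp_scaled]
  rw [integral_const_mul, integral_finsetSum]
  · have h1 := Finset.sum_le_sum fun (j : Fin m) (_ : j ∈ Finset.univ) =>
      integral_sq_norm_empirical_sub_chrc_le P hn (ω j)
    rw [Finset.sum_const, Finset.card_univ, Fintype.card_fin, nsmul_eq_mul] at h1
    rcases Nat.eq_zero_or_pos m with hm | hm
    · subst hm
      simp
    · have hm0 : (0 : ℝ) < m := by exact_mod_cast hm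
      calc _ ≤ 1 / (m : ℝ) * (m * (1 / n)) := by gcongr
        _ = (n : ℝ)⁻¹ := by field_simp
  · intro j _
    refine Integrable.of_bound (Measurable.aestronglyMeasurable ?_) (2 ^ 2)
      (Filter.Eventually.of_forall fun x => ?_)
    · have : ∀ i : Fin n, Measurable fun x : Fin n → Vec d => x i := measurable_pi_apply
      fun_prop
    · rw [norm_pow, norm_norm]
      exact pow_le_pow_left₀ (norm_nonneg _) (norm_empirical_sub_chrc_le_two P hn (ω j) x) 2

/-- By Cauchy-Schwarz the mean is at most `1/√n`, and McDiarmid with `s = √(2 log (2/ρ))/√n` has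
tail `exp (-n s²/2) = ρ/2`. -/
lemma measure_pi_ge_le_of_second_moment {E : Type*} [MeasurableSpace E] {μ : Measure E}
    [IsProbabilityMeasure μ] (hn : 1 ≤ n) {f : (Fin n → E) → ℝ} (hfm : Measurable f)
    (hf0 : ∀ x, 0 ≤ f x) (hf2 : ∀ x, f x ≤ 2)
    (hdiff : ∀ x i y, |f x - f (Function.update x i y)| ≤ 2 / n)
    (hsq : ∫ x, f x ^ 2 ∂(Measure.pi fun _ : Fin n => μ) ≤ (n : ℝ)⁻¹) {ρ : ℝ} (hρ : 0 < ρ)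
    (hρ1 : ρ ≤ 2) :
    (Measure.pi fun _ : Fin n => μ) {x | (1 + √(2 * Real.log (2 / ρ))) / √(n : ℝ) ≤ f x}
      ≤ ENNReal.ofReal (ρ / 2) := by
  have hn0 : (0 : ℝ) < n := by exact_mod_cast hn
  set ν := Measure.pi fun _ : Fin n => μ with hν
  have hmean : ∫ x, f x ∂ν ≤ 1 / √(n : ℝ) := by
    have hcs := integral_mul_le_sqrt_mul_sqrt (P := ν) hfm measurable_const (c := 2)
      (g := fun _ => (1 : ℝ)) hf0 (fun _ => zero_le_one) hf2 (fun _ => one_le_two)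
    simp only [mul_one, one_pow, integral_const, probReal_univ, smul_eq_mul, Real.sqrt_one] at hcs
    refine hcs.trans ?_
    rw [one_div, ← Real.sqrt_inv]
    exact Real.sqrt_le_sqrt hsq
  set s := √(2 * Real.log (2 / ρ)) / √(n : ℝ) with hs
  have hs0 : 0 ≤ s := by positivity
  have hlog : 0 ≤ Real.log (2 / ρ) := Real.log_nonneg (by rw [le_div_iff₀ hρ]; linarith)
  have hmc := measure_pi_ge_le_of_bounded_differences (μ := μ) hn hfm (C := 2)
    (fun x => by rw [abs_of_nonneg (hf0 x)]; exact hf2 x) hdiff hs0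
  have hexp : Real.exp (-(n * s ^ 2 / 2)) = ρ / 2 := by
    have : n * s ^ 2 / 2 = Real.log (2 / ρ) := by
      rw [hs, div_pow, Real.sq_sqrt (by positivity), Real.sq_sqrt hn0.le]
      field_simp
    rw [this, Real.exp_neg, Real.exp_log (by positivity), inv_div]
  rw [hexp] at hmc
  refine (measure_mono fun x hx => ?_).trans hmc
  simp only [Set.mem_ofPred_eq] at hx ⊢
  refine le_trans ?_ hx
  rw [add_div]
  linarith

/-- Concentration of the empirical sketch around the sketch. -/
lemma measure_norm_empiricalSketch_sub_ge_le (P : ProbabilityMeasure (Vec d)) (hn : 1 ≤ n)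
    (ω : Fin m → Vec d) {ρ : ℝ} (hρ : 0 < ρ) (hρ1 : ρ ≤ 2) :
    (Measure.pi fun _ : Fin n => (P : Measure (Vec d)))
        {x | (1 + √(2 * Real.log (2 / ρ))) / √(n : ℝ) ≤ ‖empiricalSketch ω x - sketch ω P‖}
      ≤ ENNReal.ofReal (ρ / 2) := by
  have hpair : Measurable fun x : Fin n → Vec d => (x, ω) := measurable_id.prodMk measurable_const
  have hfm := (measurable_norm_empiricalSketch_sub_sketch (m := m) (n := n) P).comp hpair
  have hdiff : ∀ (x : Fin n → Vec d) i y, |‖empiricalSketch ω x - sketch ω P‖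
      - ‖empiricalSketch ω (Function.update x i y) - sketch ω P‖| ≤ 2 / n := fun x i y => by
    refine (abs_norm_sub_norm_le _ _).trans ?_
    rw [sub_sub_sub_cancel_right]
    exact norm_empiricalSketch_sub_update_le hn ω x i y
  exact measure_pi_ge_le_of_second_moment
    (f := fun x : Fin n → Vec d => ‖empiricalSketch ω x - sketch ω P‖) hn hfm
    (fun _ => norm_nonneg _) (norm_empiricalSketch_sub_sketch_le_two P hn ω) hdiff
    (integral_sq_norm_empiricalSketch_sub_le P hn ω) hρ hρ1

end Sketch

/-! ### The constants of the model and a net of the parameter set -/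

section Constants

variable {d : ℕ} {T : Set (Param d)}

lemma isCompact_variances (hT : IsCompact T) : IsCompact {v : ℝ | ∃ θ ∈ T, ∃ l, v = θ.snd l} := by
  have h : {v : ℝ | ∃ θ ∈ T, ∃ l, v = θ.snd l} = ⋃ l : Fin d, (fun θ : Param d => θ.snd l) '' T := by
    ext v
    simp only [Set.mem_ofPred_eq, Set.mem_iUnion, Set.mem_image]
    constructor
    · rintro ⟨θ, hθ, l, rfl⟩
      exact ⟨l, θ, hθ, rfl⟩
    · rintro ⟨l, θ, hθ, rfl⟩
      exact ⟨θ, hθ, l, rfl⟩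
  rw [h]
  exact isCompact_iUnion fun l => hT.image (by fun_prop)

lemma snd_mem_Icc (hT : IsCompact T) {θ : Param d} (hθ : θ ∈ T) (l : Fin d) :
    θ.snd l ∈ Set.Icc (varMin T) (varMax T) :=
  ⟨csInf_le (isCompact_variances hT).bddBelow ⟨θ, hθ, l, rfl⟩,
    le_csSup (isCompact_variances hT).bddAbove ⟨θ, hθ, l, rfl⟩⟩

lemma varMin_pos (hd : 1 ≤ d) (hT : IsCompact T) (hTne : T.Nonempty)
    (hTpos : ∀ θ ∈ T, ∀ l, 0 < θ.snd l) : 0 < varMin T := by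
  obtain ⟨θ, hθ⟩ := hTne
  obtain ⟨θ', hθ', l, hl⟩ := (isCompact_variances hT).sInf_mem ⟨_, θ, hθ, ⟨0, hd⟩, rfl⟩
  rw [varMin, hl]
  exact hTpos θ' hθ' l

lemma varMin_le_varMax (hd : 1 ≤ d) (hT : IsCompact T) (hTne : T.Nonempty) :
    varMin T ≤ varMax T := by
  obtain ⟨θ, hθ⟩ := hTne
  have h := snd_mem_Icc hT hθ ⟨0, hd⟩
  exact h.1.trans h.2

lemma norm_chrc_sub_le_constL (hd : 1 ≤ d) (hT : IsCompact T) (hTne : T.Nonempty)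
    (hTpos : ∀ θ ∈ T, ∀ l, 0 < θ.snd l) {θ θ' : Param d} (hθ : θ ∈ T) (hθ' : θ' ∈ T) (ω : Vec d) :
    ‖chrc (gaussianDist θ) ω - chrc (gaussianDist θ') ω‖ ≤ constL T * ‖θ - θ'‖ :=
  norm_chrc_gaussianDist_sub_le (varMin_pos hd hT hTne hTpos) (le_max_left _ _) (le_max_right _ _)
    (fun i => (snd_mem_Icc hT hθ i).1) (fun i => (snd_mem_Icc hT hθ' i).1) ω

lemma constL_pos (hl : 0 < varMin T) : 0 < constL T :=
  lt_of_lt_of_le (by positivity) (le_max_left _ _)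

/-- The left side is what the moment comparison needs; `D²` exceeds it because `D₁/(1 - e^{-D₁}) ≥
1` and `constL² ≥ 1/σ²_min`. -/
lemma le_sq_constD (hd : 1 ≤ d) {a : ℝ} (ha : 0 < a) (hl : 0 < varMin T)
    (hlu : varMin T ≤ varMax T) :
    2 * d * Real.exp (3 * a * varMax T) / (a * varMin T) ≤ constD T a ^ 2 := by
  have hd0 : (0 : ℝ) < d := by exact_mod_cast hd
  have hu : 0 < varMax T := hl.trans_le hlu
  have hD : 0 < constD₁ T a := by
    unfold constD₁
    positivity
  have h1 : 1 - Real.exp (-constD₁ T a) ≤ constD₁ T a := by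
    have := Real.add_one_le_exp (-constD₁ T a)
    linarith
  have h0 : 0 < 1 - Real.exp (-constD₁ T a) := by
    rw [sub_pos, Real.exp_lt_one_iff]
    linarith
  have hL : (varMin T)⁻¹ ≤ constL T ^ 2 := by
    have := pow_le_pow_left₀ (by positivity) (le_max_left (√(varMin T))⁻¹ ((varMin T)⁻¹ / √2)) 2
    rwa [inv_pow, Real.sq_sqrt hl.le] at this
  rw [constD, mul_pow, Real.sq_sqrt (by positivity)]
  calc 2 * d * Real.exp (3 * a * varMax T) / (a * varMin T)
      = (varMin T)⁻¹ * (2 * d * Real.exp (3 * a * varMax T) / a) := by field_simp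
    _ ≤ constL T ^ 2 * (2 * d * constD₁ T a * Real.exp (3 * a * varMax T)
          / (a * (1 - Real.exp (-constD₁ T a)))) := by
        refine mul_le_mul hL ?_ (by positivity) (sq_nonneg _)
        rw [div_le_div_iff₀ ha (by positivity)]
        have : 0 ≤ 2 * d * Real.exp (3 * a * varMax T) * a := by positivity
        nlinarith [mul_le_mul_of_nonneg_left h1 this]

lemma nonempty_chebyshev (hT : IsCompact T) :
    {r | 0 < r ∧ ∃ c : Param d, T ⊆ Metric.closedBall c r}.Nonempty := by
  obtain ⟨r, hr⟩ := hT.isBounded.subset_closedBall (0 : Param d)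
  exact ⟨max r 1, by positivity, 0, hr.trans (Metric.closedBall_subset_closedBall (le_max_left _ _))⟩

lemma norm_sub_le_two_mul_chebyshevRadius (hT : IsCompact T) {θ θ' : Param d} (hθ : θ ∈ T)
    (hθ' : θ' ∈ T) : ‖θ - θ'‖ ≤ 2 * chebyshevRadius T := by
  have h : ‖θ - θ'‖ / 2 ≤ chebyshevRadius T := by
    refine le_csInf (nonempty_chebyshev hT) ?_
    rintro r ⟨_, c, hc⟩
    have h1 := Metric.mem_closedBall.1 (hc hθ)
    have h2 := Metric.mem_closedBall'.1 (hc hθ')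
    have h3 := dist_triangle θ c θ'
    rw [dist_eq_norm θ θ'] at h3
    linarith
  linarith

/-- The net has resolution `η/(10L)`, so characteristic functions move by at most `η/10`. The base
of the cardinality bound is `C²/η²` when `L = constL T`, as `C² = 24 · 8 · L · rad(T)`. -/
lemma exists_net (hT : IsCompact T) {L η : ℝ} (hL : 0 < L) (hη : 0 < η) (hη1 : η ≤ 1)
    (hw : η ≤ 2 * (L * chebyshevRadius T)) :
    ∃ s : Finset (Param d), ↑s ⊆ T ∧ (∀ θ ∈ T, ∃ θ' ∈ s, L * ‖θ - θ'‖ ≤ η / 10) ∧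
      (s.card : ℝ) ≤ (192 * (L * chebyshevRadius T) / η ^ 2) ^ (2 * d) := by
  have hrad : 0 < chebyshevRadius T := by
    by_contra! h
    nlinarith [mul_nonneg hL.le (neg_nonneg.2 h)]
  -- Twice the radius leaves room, so attainment of the infimum is not needed.
  obtain ⟨r, ⟨hr0, c, hc⟩, hr⟩ := exists_lt_of_csInf_lt (nonempty_chebyshev hT)
    (by rw [← chebyshevRadius]; linarith : sInf {r | 0 < r ∧ ∃ c : Param d,
      T ⊆ Metric.closedBall c r} < 2 * chebyshevRadius T)
  have hε : 0 < η / (10 * L) := by positivity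
  obtain ⟨s, hsT, hcov, hcard⟩ := exists_finset_cover hr0.le hε hc
  refine ⟨s, hsT, fun θ hθ => ?_, hcard.trans ?_⟩
  · obtain ⟨θ', hθ', h⟩ := hcov θ hθ
    refine ⟨θ', hθ', ?_⟩
    rw [dist_eq_norm] at h
    calc L * ‖θ - θ'‖ ≤ L * (η / (10 * L)) := by gcongr
      _ = η / 10 := by field_simp
  · have hfr : Module.finrank ℝ (Param d) = 2 * d := by
      rw [(WithLp.linearEquiv 2 ℝ (Vec d × Vec d)).finrank_eq, Module.finrank_prod,
        finrank_euclideanSpace, Fintype.card_fin]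
      ring
    rw [hfr]
    refine pow_le_pow_left₀ (by positivity) ?_ _
    set w := L * chebyshevRadius T with hwdef
    have hw0 : 0 < w := by positivity
    have h1 : 2 * r / (η / (10 * L)) ≤ 40 * w / η := by
      rw [hwdef, div_le_div_iff₀ hε hη]
      calc 2 * r * η ≤ 2 * (2 * chebyshevRadius T) * η := by gcongr
        _ = 40 * (L * chebyshevRadius T) * (η / (10 * L)) := by field_simp; norm_num
    -- The lower bound on the diameter scale absorbs the additive one of the covering bound.
    have h2 : 1 ≤ 2 * w / η := by rw [le_div_iff₀ hη]; linarith
    have h3 : 42 * w / η ≤ 192 * w / η ^ 2 := by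
      rw [div_le_div_iff₀ hη (by positivity)]
      nlinarith [mul_nonneg hw0.le hη.le, mul_nonneg (mul_nonneg hw0.le hη.le) (sub_nonneg.2 hη1)]
    calc 1 + 2 * r / (η / (10 * L)) ≤ 2 * w / η + 40 * w / η := add_le_add h2 h1
      _ = 42 * w / η := by ring
      _ ≤ _ := h3

end Constants

/-! ### Lower restricted isometry of the random sketch -/

section RestrictedIsometry

variable {d m : ℕ} {T : Set (Param d)}

/-- The threshold `γ²/4` is the event that the sketches are at distance at most `γ/2`. The lower
bound on `γ` matters only when `A = 2/η`. -/
lemma measure_sum_norm_chrc_sub_le (hd : 1 ≤ d) (hT : IsCompact T) (hTne : T.Nonempty)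
    (hTpos : ∀ θ ∈ T, ∀ l, 0 < θ.snd l) {a : ℝ} (ha : 0 < a) {η : ℝ} (hη : 0 < η)
    {θ θ' : Param d} (hθ : θ ∈ T) (hθ' : θ' ∈ T)
    (hγ : 9 / 10 * η < mmd (freqDist d a) (gaussianDist θ) (gaussianDist θ')) :
    (Measure.pi fun _ : Fin m => freqDist d a)
        {ω | ∑ j, ‖chrc (gaussianDist θ) (ω j) - chrc (gaussianDist θ') (ω j)‖ ^ 2
          ≤ m * (mmd (freqDist d a) (gaussianDist θ) (gaussianDist θ') ^ 2 / 4)}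
      ≤ ENNReal.ofReal (Real.exp (-(m / (12 * constA T a η ^ 2)))) := by
  set Λ := freqDist d a with hΛ
  set γ := mmd Λ (gaussianDist θ) (gaussianDist θ') with hγdef
  set X : Vec d → ℝ := fun ω => ‖chrc (gaussianDist θ) ω - chrc (gaussianDist θ') ω‖ ^ 2 with hX
  have hl := varMin_pos hd hT hTne hTpos
  have hlu := varMin_le_varMax hd hT hTne
  have hd0 : (0 : ℝ) < d := by exact_mod_cast hd
  have hγ0 : 0 < γ := lt_trans (by positivity) hγ
  have hXm : Measurable X := by fun_prop
  have hX0 : ∀ ω, 0 ≤ X ω := fun ω => sq_nonneg _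
  have hX4 : ∀ ω, X ω ≤ 4 := fun ω => by
    have := pow_le_pow_left₀ (norm_nonneg _) (norm_chrc_sub_le_two (gaussianDist θ)
      (gaussianDist θ') ω) 2
    linarith
  have hEX : ∫ ω, X ω ∂Λ = γ ^ 2 := (sq_mmd _ _ _).symm
  have hXi : Integrable X Λ := integrable_of_nonneg_of_le hXm hX0 hX4
  have hD0 : 0 < constD T a := by
    have h1 := le_sq_constD (T := T) hd ha hl hlu
    have h2 : 0 < 2 * d * Real.exp (3 * a * varMax T) / (a * varMin T) := by positivity
    have h3 : 0 ≤ constD T a := mul_nonneg (constL_pos hl).le (Real.sqrt_nonneg _)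
    rcases h3.lt_or_eq with h | h
    · exact h
    · rw [← h] at h1
      linarith
  have hA0 : 0 < constA T a η := lt_min hD0 (by positivity)
  have hsec : ∫ ω, X ω ^ 2 ∂Λ ≤ 27 / 8 * constA T a η ^ 2 * (γ ^ 2) ^ 2 := by
    rcases min_choice (constD T a) (2 / η) with h | h
    · rw [constA, h, ← hEX]
      refine (integral_norm_chrc_sub_pow_four_le hd ha hl hlu (snd_mem_Icc hT hθ)
        (snd_mem_Icc hT hθ')).trans ?_
      refine mul_le_mul_of_nonneg_right ?_ (sq_nonneg _)
      exact mul_le_mul_of_nonneg_left (le_sq_constD hd ha hl hlu) (by norm_num)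
    -- Here `X ≤ 4` gives `E X² ≤ 4 γ²`, and `(27/2)(γ/η)² ≥ 4` because `γ > 9η/10`.
    · rw [constA, h]
      have h1 : ∫ ω, X ω ^ 2 ∂Λ ≤ ∫ ω, 4 * X ω ∂Λ := by
        refine integral_mono (integrable_of_nonneg_of_le (hXm.pow_const 2) (fun _ => sq_nonneg _)
          fun ω => pow_le_pow_left₀ (hX0 ω) (hX4 ω) 2) (hXi.const_mul 4) fun ω => ?_
        simp only [sq]
        exact mul_le_mul_of_nonneg_right (hX4 ω) (hX0 ω)
      rw [integral_const_mul, hEX] at h1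
      refine h1.trans ?_
      have h2 : (9 / 10 * η) ^ 2 ≤ γ ^ 2 := pow_le_pow_left₀ (by positivity) hγ.le 2
      have h3 : 27 / 8 * (2 / η) ^ 2 * (γ ^ 2) ^ 2 = 27 / 2 * γ ^ 2 / η ^ 2 * γ ^ 2 := by
        field_simp
        norm_num
      rw [h3]
      refine mul_le_mul_of_nonneg_right ?_ (sq_nonneg _)
      rw [le_div_iff₀ (by positivity)]
      nlinarith
  have h := measure_pi_sum_le_quarter (μ := Λ) hXm hX0 hX4 (by rw [hEX]; positivity)
    (K := 27 / 8 * constA T a η ^ 2) (by positivity) (by rw [hEX]; exact hsec) m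
  rw [hEX] at h
  refine h.trans (le_of_eq ?_)
  congr 3
  field_simp
  ring

/-- A lower restricted isometry property of the sketch at a point of the model. -/
lemma exists_bad_frequencies (hd : 1 ≤ d) (hT : IsCompact T) (hTne : T.Nonempty)
    (hTpos : ∀ θ ∈ T, ∀ l, 0 < θ.snd l) {a : ℝ} (ha : 0 < a) {η : ℝ} (hη : 0 < η) (hη1 : η ≤ 1)
    {ρ : ℝ} (hρ : 0 < ρ)
    (hm : 12 * constA T a η ^ 2 * (4 * d * Real.log (constC T / η) + Real.log (2 / ρ)) ≤ m)
    {θ₀ : Param d} (hθ₀ : θ₀ ∈ T) :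
    ∃ bad : Set (Fin m → Vec d), (Measure.pi fun _ : Fin m => freqDist d a) bad
        ≤ ENNReal.ofReal (ρ / 2) ∧
      ∀ ω, ω ∉ bad → ∀ θ ∈ T, mmd (freqDist d a) (gaussianDist θ₀) (gaussianDist θ)
        ≤ 2 * ‖sketch ω (gaussianDist θ₀) - sketch ω (gaussianDist θ)‖ + η := by
  classical
  set Λ := freqDist d a with hΛ
  set L := constL T with hLdef
  have hl := varMin_pos hd hT hTne hTpos
  have hlu := varMin_le_varMax hd hT hTne
  have hd0 : (0 : ℝ) < d := by exact_mod_cast hd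
  have hL : 0 < L := constL_pos hl
  have hlip : ∀ θ ∈ T, ∀ θ' ∈ T, ∀ ω, _ := fun θ hθ θ' hθ' ω =>
    norm_chrc_sub_le_constL hd hT hTne hTpos hθ hθ' ω
  -- If the scale `2 L rad(T)` is below `η`, all discrepancies within the model are below `η` and no
  -- frequency is bad.
  rcases lt_or_ge (2 * (L * chebyshevRadius T)) η with hw | hw
  · refine ⟨∅, by simp, fun ω _ θ hθ => ?_⟩
    have h1 : mmd Λ (gaussianDist θ₀) (gaussianDist θ) ≤ 2 * (L * chebyshevRadius T) :=
      mmd_le_of_forall_norm_le Λ fun ω => (hlip θ₀ hθ₀ θ hθ ω).trans (by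
        have := mul_le_mul_of_nonneg_left (norm_sub_le_two_mul_chebyshevRadius hT hθ₀ hθ) hL.le
        linarith)
    have h2 := norm_nonneg (sketch ω (gaussianDist θ₀) - sketch ω (gaussianDist θ))
    linarith
  · obtain ⟨s, hsT, hcov, hcard⟩ := exists_net hT hL hη hη1 hw
    set q := 192 * (L * chebyshevRadius T) / η ^ 2 with hq
    have hw0 : 0 < L * chebyshevRadius T := by linarith
    have hq0 : 0 < q := by positivity
    have hlog : Real.log (constC T / η) = Real.log q / 2 := by
      have : constC T / η = √q := by
        rw [hq, Real.sqrt_div (by positivity), Real.sqrt_sq hη.le, constC, constB]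
        congr 2
        rw [hLdef]
        ring
      rw [this, Real.log_sqrt hq0.le]
    set γ : Param d → ℝ := fun θ => mmd Λ (gaussianDist θ₀) (gaussianDist θ) with hγ
    set B : Param d → Set (Fin m → Vec d) := fun θ =>
      {ω | ∑ j, ‖chrc (gaussianDist θ₀) (ω j) - chrc (gaussianDist θ) (ω j)‖ ^ 2
        ≤ m * (γ θ ^ 2 / 4)} with hB
    -- Only net points at discrepancy above `9η/10` from `θ₀` need control. Since `θ₀` is fixed, the
    -- union bound runs over the net and not over pairs.
    refine ⟨⋃ θ ∈ s.filter fun θ => 9 / 10 * η < γ θ, B θ, ?_, ?_⟩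
    · refine (measure_biUnion_finset_le _ _).trans ?_
      have hA0 : 0 < constA T a η ^ 2 := by
        have h1 := le_sq_constD (T := T) hd ha hl hlu
        have h2 : 0 < 2 * d * Real.exp (3 * a * varMax T) / (a * varMin T) := by positivity
        rcases min_choice (constD T a) (2 / η) with h | h
        · rw [constA, h]; linarith
        · rw [constA, h]; positivity
      have hexp : Real.exp (-(m / (12 * constA T a η ^ 2))) ≤ (q ^ (2 * d))⁻¹ * (ρ / 2) := by
        have h1 : 2 * d * Real.log q + Real.log (2 / ρ) ≤ m / (12 * constA T a η ^ 2) := by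
          rw [le_div_iff₀ (by positivity)]
          rw [hlog] at hm
          linarith
        calc Real.exp (-(m / (12 * constA T a η ^ 2)))
            ≤ Real.exp (-(2 * d * Real.log q + Real.log (2 / ρ))) :=
              Real.exp_le_exp.2 (neg_le_neg h1)
          _ = (q ^ (2 * d))⁻¹ * (ρ / 2) := by
              rw [neg_add, Real.exp_add, Real.exp_neg, Real.exp_neg,
                Real.exp_log (by positivity), inv_div]
              congr 2
              rw [show 2 * (d : ℝ) * Real.log q = ((2 * d : ℕ) : ℝ) * Real.log q by push_cast; ring,
                Real.exp_nat_mul, Real.exp_log hq0]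
      calc ∑ θ ∈ s.filter fun θ => 9 / 10 * η < γ θ, (Measure.pi fun _ : Fin m => Λ) (B θ)
          ≤ ∑ θ ∈ s.filter fun θ => 9 / 10 * η < γ θ,
              ENNReal.ofReal ((q ^ (2 * d))⁻¹ * (ρ / 2)) := by
            refine Finset.sum_le_sum fun θ hθ => ?_
            rw [Finset.mem_filter] at hθ
            exact (measure_sum_norm_chrc_sub_le hd hT hTne hTpos ha hη hθ₀ (hsT hθ.1) hθ.2).trans
              (ENNReal.ofReal_le_ofReal hexp)
        _ = ENNReal.ofReal ((s.filter fun θ => 9 / 10 * η < γ θ).card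
              * ((q ^ (2 * d))⁻¹ * (ρ / 2))) := by
            rw [Finset.sum_const, nsmul_eq_mul, ENNReal.ofReal_mul (Nat.cast_nonneg _),
              ENNReal.ofReal_natCast]
        _ ≤ ENNReal.ofReal (ρ / 2) := by
            refine ENNReal.ofReal_le_ofReal ?_
            have h1 : ((s.filter fun θ => 9 / 10 * η < γ θ).card : ℝ) ≤ q ^ (2 * d) :=
              le_trans (by exact_mod_cast Finset.card_filter_le _ _) hcard
            calc _ ≤ q ^ (2 * d) * ((q ^ (2 * d))⁻¹ * (ρ / 2)) := by gcongr
              _ = ρ / 2 := by field_simp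
    -- Passing to a net point `θ'` costs `η/10` in `γ` and `η/10` in the sketch. A near `θ'` gives
    -- `γ θ ≤ 9η/10 + η/10`; a far one gives `γ θ ≤ 2 ‖·‖ + 3η/10`.
    · intro ω hω θ hθ
      obtain ⟨θ', hθ's, hθθ'⟩ := hcov θ hθ
      have hθ' : θ' ∈ T := hsT hθ's
      have hχ : ∀ ω, ‖chrc (gaussianDist θ') ω - chrc (gaussianDist θ) ω‖ ≤ η / 10 := fun ω => by
        rw [norm_sub_rev]
        exact (hlip θ hθ θ' hθ' ω).trans hθθ'
      have h1 : γ θ ≤ γ θ' + η / 10 :=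
        (mmd_triangle Λ _ (gaussianDist θ') _).trans
          (add_le_add_right (mmd_le_of_forall_norm_le Λ hχ) _)
      have h2 := norm_nonneg (sketch ω (gaussianDist θ₀) - sketch ω (gaussianDist θ))
      rcases le_or_gt (γ θ') (9 / 10 * η) with h3 | h3
      · change γ θ ≤ _
        linarith
      · have h4 : ω ∉ B θ' := fun h => hω (Set.mem_biUnion
          (Finset.mem_coe.2 (Finset.mem_filter.2 ⟨hθ's, h3⟩)) h)
        have h5 : m * (γ θ' ^ 2 / 4)
            < ∑ j, ‖chrc (gaussianDist θ₀) (ω j) - chrc (gaussianDist θ') (ω j)‖ ^ 2 := by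
          simpa [hB] using h4
        have hm0 : (0 : ℝ) < m := by
          rcases Nat.eq_zero_or_pos m with h | h
          · subst h
            simp at h5
          · exact_mod_cast h
        have h6 : (γ θ' / 2) ^ 2 ≤ ‖sketch ω (gaussianDist θ₀) - sketch ω (gaussianDist θ')‖ ^ 2 := by
          rw [sq_norm_sketch_sub, one_div, inv_mul_eq_div, le_div_iff₀ hm0]
          linarith
        have h7 : γ θ' / 2 ≤ ‖sketch ω (gaussianDist θ₀) - sketch ω (gaussianDist θ')‖ :=
          (abs_le_of_sq_le_sq' h6 (norm_nonneg _)).2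
        have h8 : ‖sketch ω (gaussianDist θ) - sketch ω (gaussianDist θ')‖ ≤ η / 10 :=
          norm_sketch_sub_le (fun ω => by rw [norm_sub_rev]; exact hχ ω) ω
        have h9 := norm_sub_le_norm_sub_add_norm_sub (sketch ω (gaussianDist θ₀))
          (sketch ω (gaussianDist θ)) (sketch ω (gaussianDist θ'))
        change γ θ ≤ _
        linarith

end RestrictedIsometry

/-! ### Existence of the decoder and its error -/

section Decoding

variable {d n m : ℕ} {T : Set (Param d)}

/-- The sketch is Lipschitz in the parameters on the compact set `T`, so the objective attains its
minimum. -/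
lemma exists_isIdealDecoder (hd : 1 ≤ d) (hT : IsCompact T) (hTne : T.Nonempty)
    (hTpos : ∀ θ ∈ T, ∀ l, 0 < θ.snd l) :
    ∃ Δ : EuclideanSpace ℂ (Fin m) → (Fin m → Vec d) → ProbabilityMeasure (Vec d),
      IsIdealDecoder (gaussianModel T) Δ := by
  have h : ∀ (z : EuclideanSpace ℂ (Fin m)) (ω : Fin m → Vec d),
      ∃ P ∈ gaussianModel T, IsMinOn (fun P => ‖z - sketch ω P‖) (gaussianModel T) P := by
    intro z ω
    have hL := constL_pos (varMin_pos hd hT hTne hTpos)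
    have hc : ContinuousOn (fun θ => ‖z - sketch ω (gaussianDist θ)‖) T := by
      refine (LipschitzOnWith.of_dist_le_mul (K := (constL T).toNNReal)
        fun θ hθ θ' hθ' => ?_).continuousOn
      rw [Real.coe_toNNReal _ hL.le, dist_eq_norm θ θ', Real.dist_eq]
      refine (abs_norm_sub_norm_le _ _).trans ?_
      rw [sub_sub_sub_cancel_left, norm_sub_rev]
      exact norm_sketch_sub_le (norm_chrc_sub_le_constL hd hT hTne hTpos hθ hθ') ω
    obtain ⟨θ, hθ, hmin⟩ := hT.exists_isMinOn hTne hc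
    refine ⟨gaussianDist θ, ⟨θ, hθ, rfl⟩, ?_⟩
    rintro _ ⟨θ', hθ', rfl⟩
    exact hmin hθ'
  choose Δ hΔ using h
  exact ⟨Δ, fun z ω => ⟨(hΔ z ω).1, (hΔ z ω).2⟩⟩

instance isProbabilityMeasure_drawLaw (P : ProbabilityMeasure (Vec d)) (a : ℝ) :
    IsProbabilityMeasure (drawLaw n m P (freqDist d a)) := by
  unfold drawLaw
  infer_instance

/-- The decoding error is controlled by the distance to any fixed element of the model. -/
lemma measure_decoding_error_le (hd : 1 ≤ d) (hT : IsCompact T) (hTne : T.Nonempty)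
    (hTpos : ∀ θ ∈ T, ∀ l, 0 < θ.snd l) {a : ℝ} (ha : 0 < a) {η : ℝ} (hη : 0 < η) (hη1 : η ≤ 1)
    {ρ : ℝ} (hρ : 0 < ρ) (hρ1 : ρ ≤ 2) (hn : 1 ≤ n)
    (hm : 12 * constA T a η ^ 2 * (4 * d * Real.log (constC T / η) + Real.log (2 / ρ)) ≤ m)
    (P : ProbabilityMeasure (Vec d))
    {Δ : EuclideanSpace ℂ (Fin m) → (Fin m → Vec d) → ProbabilityMeasure (Vec d)}
    (hΔ : IsIdealDecoder (gaussianModel T) Δ) {Q : ProbabilityMeasure (Vec d)}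
    (hQ : Q ∈ gaussianModel T) :
    drawLaw n m P (freqDist d a)
        {p | ¬ (mmd (freqDist d a) P (Δ (empiricalSketch p.2 p.1) p.2)
          ≤ 5 * tvDist P Q + 4 * (1 + √(2 * Real.log (2 / ρ))) / √(n : ℝ) + η)}
      ≤ ENNReal.ofReal ρ := by
  obtain ⟨θ₀, hθ₀, rfl⟩ := hQ
  set Λ := freqDist d a with hΛ
  obtain ⟨bad, hbad, hgood⟩ := exists_bad_frequencies hd hT hTne hTpos ha hη hη1 hρ hm hθ₀
  set t := (1 + √(2 * Real.log (2 / ρ))) / √(n : ℝ) with ht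
  set S : Set ((Fin n → Vec d) × (Fin m → Vec d)) :=
    {p | t ≤ ‖empiricalSketch p.2 p.1 - sketch p.2 P‖} with hS
  have hSm : MeasurableSet S :=
    measurableSet_le measurable_const (measurable_norm_empiricalSketch_sub_sketch P)
  have hSμ : drawLaw n m P Λ S ≤ ENNReal.ofReal (ρ / 2) := by
    -- The concentration bound holds for every fixed `ω`, and Fubini integrates it over the
    -- frequencies.
    rw [drawLaw, Measure.prod_apply_symm hSm]
    calc _ ≤ ∫⁻ _, ENNReal.ofReal (ρ / 2) ∂(Measure.pi fun _ : Fin m => Λ) := by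
          refine lintegral_mono fun ω => ?_
          exact measure_norm_empiricalSketch_sub_ge_le P hn ω hρ hρ1
      _ = ENNReal.ofReal (ρ / 2) := by simp
  -- The measure of a rectangle factors for arbitrary sets, so `bad` need not be measurable.
  have hBμ : drawLaw n m P Λ (Set.univ ×ˢ bad) ≤ ENNReal.ofReal (ρ / 2) := by
    rw [drawLaw, Measure.prod_prod, measure_univ, one_mul]
    exact hbad
  have hsub : {p : (Fin n → Vec d) × (Fin m → Vec d) |
      ¬ (mmd Λ P (Δ (empiricalSketch p.2 p.1) p.2) ≤ 5 * tvDist P (gaussianDist θ₀)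
        + 4 * (1 + √(2 * Real.log (2 / ρ))) / √(n : ℝ) + η)} ⊆ S ∪ Set.univ ×ˢ bad := by
    intro p hp
    by_contra hcon
    rw [Set.mem_union, not_or] at hcon
    obtain ⟨h1, h2⟩ := hcon
    have hω : p.2 ∉ bad := fun h => h2 ⟨trivial, h⟩
    have hlt : ‖empiricalSketch p.2 p.1 - sketch p.2 P‖ < t := not_le.1 h1
    refine hp ?_
    obtain ⟨hmem, hmin⟩ := hΔ (empiricalSketch p.2 p.1) p.2
    obtain ⟨θ, hθ, hθeq⟩ := hmem
    have hmin' := hmin (show gaussianDist θ₀ ∈ gaussianModel T from ⟨θ₀, hθ₀, rfl⟩)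
    simp only [Set.mem_ofPred_eq] at hmin'
    rw [← hθeq] at hmin' ⊢
    have h3 := hgood p.2 hω θ hθ
    have h4 := mmd_triangle Λ P (gaussianDist θ₀) (gaussianDist θ)
    have h5 := mmd_le_of_forall_norm_le Λ (norm_chrc_sub_le_tvDist P (gaussianDist θ₀))
    have h6 := norm_sketch_sub_le (norm_chrc_sub_le_tvDist P (gaussianDist θ₀)) p.2
    have h7 := norm_sub_le_norm_sub_add_norm_sub (sketch p.2 (gaussianDist θ₀))
      (empiricalSketch p.2 p.1) (sketch p.2 (gaussianDist θ))
    have h8 := norm_sub_le_norm_sub_add_norm_sub (empiricalSketch p.2 p.1) (sketch p.2 P)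
      (sketch p.2 (gaussianDist θ₀))
    rw [norm_sub_rev (sketch p.2 (gaussianDist θ₀)) (empiricalSketch p.2 p.1)] at h7
    -- One `TV` comes from `γ(P*, Q)`. The factor 2 of the isometry times the factor 2 from
    -- minimality multiplies `‖ẑ - 𝒜 Q‖ ≤ t + TV`.
    rw [mul_div_assoc, ← ht]
    linarith
  refine (measure_mono hsub).trans ((measure_union_le _ _).trans ((add_le_add hSμ hBμ).trans ?_))
  rw [← ENNReal.ofReal_add (by positivity) (by positivity), add_halves]

end Decoding

end SketchedGaussian

end

/-! ### From a fixed element of the model to the infimum -/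

theorem mainTheorem4 {d : ℕ} (hd : 1 ≤ d)
    (T : Set (SketchedGaussian.Param d)) (hT : IsCompact T) (hTne : T.Nonempty)
    (hTpos : ∀ θ ∈ T, ∀ l, 0 < θ.snd l)
    (a : ℝ) (ha : 0 < a) (η : ℝ) (hη : 0 < η) (hη1 : η ≤ 1) (ρ : ℝ) (hρ : 0 < ρ)
    (n m : ℕ) (hn : 1 ≤ n)
    (Pstar : MeasureTheory.ProbabilityMeasure (SketchedGaussian.Vec d)) :
    (∃ Δ : EuclideanSpace ℂ (Fin m) → (Fin m → SketchedGaussian.Vec d) →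
          MeasureTheory.ProbabilityMeasure (SketchedGaussian.Vec d),
        SketchedGaussian.IsIdealDecoder (SketchedGaussian.gaussianModel T) Δ) ∧
    (12 * SketchedGaussian.constA T a η ^ 2 *
        (4 * d * Real.log (SketchedGaussian.constC T / η) + Real.log (2 / ρ)) ≤ (m : ℝ) →
    ∀ Δ : EuclideanSpace ℂ (Fin m) → (Fin m → SketchedGaussian.Vec d) →
          MeasureTheory.ProbabilityMeasure (SketchedGaussian.Vec d),
      SketchedGaussian.IsIdealDecoder (SketchedGaussian.gaussianModel T) Δ →
      SketchedGaussian.drawLaw n m Pstar (SketchedGaussian.freqDist d a)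
        {p | ¬ (SketchedGaussian.mmd (SketchedGaussian.freqDist d a) Pstar
                  (Δ (SketchedGaussian.empiricalSketch p.2 p.1) p.2)
                ≤ 5 * SketchedGaussian.tvInfDist Pstar (SketchedGaussian.gaussianModel T)
                  + 4 * (1 + √(2 * Real.log (2 / ρ))) / √(n : ℝ) + η)}
        ≤ ENNReal.ofReal ρ) := by
  open SketchedGaussian in
  refine ⟨exists_isIdealDecoder hd hT hTne hTpos, fun hm Δ hΔ => ?_⟩
  rcases le_or_gt 1 ρ with hρ1 | hρ1
  · exact prob_le_one.trans (ENNReal.one_le_ofReal.2 hρ1)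
  have hne : (tvDist Pstar '' gaussianModel T).Nonempty := (hTne.image _).image _
  have hbdd : BddBelow (tvDist Pstar '' gaussianModel T) :=
    ⟨0, by rintro _ ⟨Q, _, rfl⟩; exact ENNReal.toReal_nonneg⟩
  -- The good event depends on `Q` through the bad frequencies, so the infimum cannot be taken
  -- inside one event. It is approached along a decreasing sequence of attained values.
  obtain ⟨u, hanti, hlim, hu⟩ := exists_seq_tendsto_sInf hne hbdd
  set B : ℕ → Set ((Fin n → Vec d) × (Fin m → Vec d)) := fun k =>
    {p | ¬ (mmd (freqDist d a) Pstar (Δ (empiricalSketch p.2 p.1) p.2)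
      ≤ 5 * u k + 4 * (1 + √(2 * Real.log (2 / ρ))) / √(n : ℝ) + η)}
  have hBmono : Monotone B := fun i j hij p hp hle => hp (hle.trans (by
    have := hanti hij
    linarith))
  have hBle : ∀ k, drawLaw n m Pstar (freqDist d a) (B k) ≤ ENNReal.ofReal ρ := fun k => by
    obtain ⟨Q, hQ, hQu⟩ := hu k
    have h := measure_decoding_error_le hd hT hTne hTpos ha hη hη1 hρ (by linarith) hn hm
      Pstar hΔ hQ
    rw [hQu] at h
    exact h
  refine (measure_mono (t := ⋃ k, B k) fun p hp => ?_).trans ?_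
  · by_contra hcon
    simp only [Set.mem_iUnion, not_exists] at hcon
    refine hp (ge_of_tendsto' (((hlim.const_mul 5).add_const _).add_const _) fun k => ?_)
    exact not_not.1 (hcon k)
  -- The failure events grow as `u k` decreases, and continuity from below keeps the bound `ρ`
  -- without a union bound. It holds for arbitrary sets, so no measurability of the decoder is
  -- required.
  · rw [hBmono.measure_iUnion]
    exact iSup_le hBle
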